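/- Let $\lambda>0$, $b>0$, $s\in\mathbb R$, put $t^\ast=b/\lambda$ and let $T\ge t^\ast$. Let $\rho_0\in L^1(0,b)$. **Supply.** For an inflow $u$, let $\rho$ be the weak solution on $[0,b]\times[0,T]$ of the scalar linear advection equation with linear source $$\partial_t\rho+\lambda\,\partial_x\rho=s\rho,\qquad \rho(x,0)=\rho_0(x),\qquad \rho(0,t)=u(t),$$ and let $S_u(t)=\rho(b,t)$ be its outflow trace at $x=b$ (determined up to null sets of times; a representative may be chosen). The transport delay is $b/\lambda$ (equal to $1/\lambda$ for an edge of length $b=1$). Admissible controls are the deterministic functions $u\in L^2([0,T])$ with $u(t)\ge 0$ on $[0,T]$. **Demand.** Let $W$ be a Brownian motion on a probability space, $\kappa,\sigma>0$, $y_0\in\mathbb R$, $\mu\in L^1(0,T)$, and let $Y$ be the Ornstein–Uhlenbeck process $$dY_t=\kappa(\mu(t)-Y_t)\,dt+\sigma\,dW_t,\qquad Y_0=y_0 .$$ Put $$m_{OUP}(t)=y_0e^{-\kappa t}+\kappa\int_0^t e^{-\kappa(t-r)}\mu(r)\,dr,\qquad v_{OUP}(t)=\frac{\sigma^2}{2\kappa}\bigl(1-e^{-2\kappa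 t}\bigr)$$ (the mean and the variance of $Y_t$) and, for a risk level $\theta\in(0,1/2]$, $$q(t)=m_{OUP}(t)+\sqrt{v_{OUP}(t)}\;\Phi^{-1}(1-\theta),$$ where $\Phi$ is the standard normal distribution function. Assume $q(t)\ge 0$ for all $t\in[t^\ast,T]$. **Optimal control problem.** Minimize the pure tracking cost $$\int_{t^\ast}^{T}\mathbb E\bigl[(S_u(t)-Y_t)^2\bigr]\,dt$$ over the admissible controls $u$, subject to the single chance constraint $$P\bigl(Y_t\le S_u(t)\bigr)\ge 1-\theta\qquad\text{for all } t\in I_{CC},$$ which is active at all times that the inflow can influence: $[t^\ast,T]\subseteq I_{CC}\subseteq[0,T]$. If $I_{CC}$ also contains times $t<t^\ast$ (for example, if $I_{CC}=[0,T]$), assume that the outflow of the initial state meets the constraint there, i.e. $P\bigl(Y_t\le e^{st}\rho_0(b-\lambda t)\bigr)\ge 1-\theta$ for almost every $t\in I_{CC}$ with $t<t^\ast$; for $I_{CC}=[t^\ast,T]$ nothing is assumed. **Theorem.** There is an optimal control $u^\ast$ with $$u^\ast(t)=e^{-sb/\lambda}\Bigl(m_{OUP}\bigl(t+\tfrac b\lambda\bigr)+\sqrt{v_{OUP}\bigl(t+\tfrac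 b\lambda\bigr)}\;\Phi^{-1}(1-\theta)\Bigr)\qquad\text{for all } t\in\bigl[0,T-\tfrac b\lambda\bigr].$$ Moreover, a control is optimal if and only if it is admissible and equals this expression for almost every $t\in[0,T-b/\lambda]$. -/

import Mathlib

open MeasureTheory ProbabilityTheory Set
open scoped NNReal ENNReal

noncomputable section

namespace SupplyControl

/-- Weak solution, with outflow trace, of the scalar linear advection equation with linear source
`∂ₜ ρ + lam ∂ₓ ρ = s ρ` on the edge `[0, b]` and the time interval `[0, T]`, with
`ρ(x, 0) = ρ₀ x` and inflow `ρ(0, t) = u t`. Points of the plane are pairs `(x, t)`.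
The function `S` is the boundary trace `S t = ρ(b, t)` at the outflow end `x = b`; it enters
through the boundary term of the integration by parts. The test functions are smooth, compactly
supported in the plane, and supported in times `t < T`; at `t = 0`, `x = 0` and `x = b` they are
unrestricted. -/
structure IsWeakSolution (lam s b T : ℝ) (ρ₀ u : ℝ → ℝ) (ρ : ℝ × ℝ → ℝ) (S : ℝ → ℝ) : Prop where
  integrableOn_density : IntegrableOn ρ (Icc 0 b ×ˢ Icc 0 T)
  integrableOn_outflow : IntegrableOn S (Icc 0 T)
  weak_form : ∀ φ : ℝ × ℝ → ℝ, ContDiff ℝ (⊤ : ℕ∞) φ → HasCompactSupport φ →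
    tsupport φ ⊆ {p : ℝ × ℝ | p.2 < T} →
    (∫ p in Icc (0 : ℝ) b ×ˢ Icc (0 : ℝ) T,
        ρ p * (fderiv ℝ φ p (0, 1) + lam * fderiv ℝ φ p (1, 0) + s * φ p))
      + (∫ x in Icc 0 b, ρ₀ x * φ (x, 0))
      + lam * (∫ t in Icc 0 T, u t * φ (0, t))
      - lam * (∫ t in Icc 0 T, S t * φ (b, t)) = 0

/-- `S` is the supply `t ↦ ρ(b, t)` at the demand node produced by the inflow `u`. -/
def IsSupply (lam s b T : ℝ) (ρ₀ u S : ℝ → ℝ) : Prop :=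
  ∃ ρ : ℝ × ℝ → ℝ, IsWeakSolution lam s b T ρ₀ u ρ S

/-- Admissible controls: nonnegative, square-integrable, deterministic inflows on `[0, T]`. -/
structure IsAdmissible (T : ℝ) (u : ℝ → ℝ) : Prop where
  memLp : MemLp u 2 (volume.restrict (Icc 0 T))
  nonneg : ∀ t ∈ Icc 0 T, 0 ≤ u t

/-- `Y` is, on `[0, T]`, a time-inhomogeneous Ornstein–Uhlenbeck process, that is, a continuous
solution of `dY = κ (μ t - Y) dt + σ dW`, `Y 0 = y₀`. As the noise is additive, the stochastic
integral of the constant `σ` is `σ (W t - W 0) = σ W t`. -/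
structure IsOUProcess {Ω : Type*} [MeasurableSpace Ω] (P : Measure Ω) (W : ℝ≥0 → Ω → ℝ)
    (κ σ y₀ : ℝ) (μ : ℝ → ℝ) (T : ℝ) (Y : ℝ → Ω → ℝ) : Prop where
  aemeasurable : ∀ t ∈ Icc 0 T, AEMeasurable (Y t) P
  continuousOn_path : ∀ᵐ w ∂P, ContinuousOn (fun t => Y t w) (Icc 0 T)
  integral_eq : ∀ᵐ w ∂P, ∀ t ∈ Icc 0 T,
    Y t w = y₀ + (∫ r in (0 : ℝ)..t, κ * (μ r - Y r w)) + σ * W t.toNNReal w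

/-- Mean of the Ornstein–Uhlenbeck process at time `t`. -/
def meanOUP (κ y₀ : ℝ) (μ : ℝ → ℝ) (t : ℝ) : ℝ :=
  y₀ * Real.exp (-κ * t) + κ * ∫ r in (0 : ℝ)..t, Real.exp (-κ * (t - r)) * μ r

/-- Variance of the Ornstein–Uhlenbeck process at time `t`. -/
def varOUP (κ σ t : ℝ) : ℝ :=
  σ ^ 2 / (2 * κ) * (1 - Real.exp (-2 * κ * t))

/-- The quantile function `Φ⁻¹` of the standard normal distribution (for `0 < p < 1`). -/
def stdNormalQuantile (p : ℝ) : ℝ :=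
  sInf {z : ℝ | p ≤ cdf (gaussianReal 0 1) z}

/-- The pointwise normal-quantile bound at risk level `θ`: mean plus standard deviation times
`Φ⁻¹(1 - θ)`. -/
def quantileBound (κ σ y₀ : ℝ) (μ : ℝ → ℝ) (θ t : ℝ) : ℝ :=
  meanOUP κ y₀ μ t + Real.sqrt (varOUP κ σ t) * stdNormalQuantile (1 - θ)

/-- The single chance constraint on `I`: at each time in `I`, the demand is satisfied with
probability at least `1 - θ`. -/
def SingleChanceConstraint {Ω : Type*} [MeasurableSpace Ω] (P : Measure Ω) (Y : ℝ → Ω → ℝ)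
    (θ : ℝ) (I : Set ℝ) (S : ℝ → ℝ) : Prop :=
  ∀ t ∈ I, ENNReal.ofReal (1 - θ) ≤ P {w | Y t w ≤ S t}

/-- Pure tracking cost `∫_{t₁}^{T} 𝔼[(S t - Y t)²] dt`, as an element of `[0, ∞]`. -/
def trackingCost {Ω : Type*} [MeasurableSpace Ω] (P : Measure Ω) (Y : ℝ → Ω → ℝ)
    (t₁ T : ℝ) (S : ℝ → ℝ) : ℝ≥0∞ :=
  ∫⁻ t in Icc t₁ T, ∫⁻ w, ENNReal.ofReal ((S t - Y t w) ^ 2) ∂P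

/-- The constraints of the control problem: `u` is admissible, `S` is the supply produced by `u`,
and `S` satisfies the single chance constraint on `I`. -/
structure IsFeasible {Ω : Type*} [MeasurableSpace Ω] (P : Measure Ω) (Y : ℝ → Ω → ℝ)
    (lam s b T : ℝ) (ρ₀ : ℝ → ℝ) (θ : ℝ) (I : Set ℝ) (u S : ℝ → ℝ) : Prop where
  admissible : IsAdmissible T u
  supply : IsSupply lam s b T ρ₀ u S
  chance : SingleChanceConstraint P Y θ I S

/-- `u` is an optimal control: it is feasible and its tracking cost over `[b / lam, T]`
is minimal among all feasible controls. Here `b / lam` is the first time at which the inflow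
reaches the demand node. -/
def IsOptimalControl {Ω : Type*} [MeasurableSpace Ω] (P : Measure Ω) (Y : ℝ → Ω → ℝ)
    (lam s b T : ℝ) (ρ₀ : ℝ → ℝ) (θ : ℝ) (I : Set ℝ) (u : ℝ → ℝ) : Prop :=
  ∃ S : ℝ → ℝ, IsFeasible P Y lam s b T ρ₀ θ I u S ∧
    ∀ u' S' : ℝ → ℝ, IsFeasible P Y lam s b T ρ₀ θ I u' S' →
      trackingCost P Y (b / lam) T S ≤ trackingCost P Y (b / lam) T S'

/-- The closed-form control: the quantile bound one transport delay `b / lam` ahead, divided by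
the factor `exp (s b / lam)` that the source term applies along the edge. -/
def optimalInflow (lam s b κ σ y₀ : ℝ) (μ : ℝ → ℝ) (θ t : ℝ) : ℝ :=
  Real.exp (-(s * b / lam)) * quantileBound κ σ y₀ μ θ (t + b / lam)

end SupplyControl

end

/-!
Duhamel's formula writes the Ornstein–Uhlenbeck process as its mean plus a pathwise Stieltjes
integral of the smooth kernel `exp (-κ (t - r))` against the Brownian path, a limit of Gaussian sums
of independent increments; so `Y t` is normal with mean `meanOUP` and variance `varOUP`, and the
chance constraint at time `t` says exactly that the outflow is at least the quantile bound `q t`.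

Testing the weak form against functions that are constant along the characteristics, up to the
factor undoing the source, determines the outflow almost everywhere: for `t > b / lam` it is
`exp (s b / lam) u (t - b / lam)`. The tracking cost is the integral of `Var Y + (S - 𝔼 Y)²`.
Since `θ ≤ 1 / 2`, the bound `q` lies above the mean, so among outflows `S ≥ q` the integrand is
least at `S = q` and nowhere else; as `q ≥ 0`, the inflow producing the outflow `q` is admissible.
-/

namespace SupplyControl

open Filter Topology

section Quantile

theorem bddBelow_setOf_le_cdf {p : ℝ} (hp : 0 < p) (ν : Measure ℝ) :
    BddBelow {z : ℝ | p ≤ cdf ν z} := by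
  obtain ⟨a, ha⟩ := ((tendsto_cdf_atBot ν).eventually (gt_mem_nhds hp)).exists
  exact ⟨a, fun z hz => le_of_not_gt fun hza =>
    (hz.trans (monotone_cdf ν hza.le)).not_gt ha⟩

theorem nonempty_setOf_le_cdf {p : ℝ} (hp : p < 1) (ν : Measure ℝ) :
    {z : ℝ | p ≤ cdf ν z}.Nonempty :=
  let ⟨a, ha⟩ := ((tendsto_cdf_atTop ν).eventually (lt_mem_nhds hp)).exists
  ⟨a, le_of_lt ha⟩

theorem le_cdf_sInf {p : ℝ} (hp : p < 1) (ν : Measure ℝ) :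
    p ≤ cdf ν (sInf {z : ℝ | p ≤ cdf ν z}) := by
  set c := sInf {z : ℝ | p ≤ cdf ν z}
  have hright : Tendsto (cdf ν) (𝓝[>] c) (𝓝 (cdf ν c)) :=
    ((cdf ν).right_continuous c).mono_left (nhdsWithin_mono _ Ioi_subset_Ici_self)
  refine ge_of_tendsto hright ?_
  filter_upwards [self_mem_nhdsWithin] with z hz
  obtain ⟨y, hy, hyz⟩ := exists_lt_of_csInf_lt (nonempty_setOf_le_cdf hp ν) hz
  exact le_trans hy (monotone_cdf ν hyz.le)

theorem stdNormalQuantile_le_iff {p : ℝ} (hp : 0 < p) (hp1 : p < 1) (z : ℝ) :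
    stdNormalQuantile p ≤ z ↔ p ≤ cdf (gaussianReal 0 1) z :=
  ⟨fun h => (le_cdf_sInf hp1 _).trans (monotone_cdf _ h),
    fun h => csInf_le (bddBelow_setOf_le_cdf hp _) h⟩

theorem cdf_gaussianReal_lt_half {z : ℝ} (hz : z < 0) : cdf (gaussianReal 0 1) z < 1 / 2 := by
  rw [cdf_eq_real]
  set ν := gaussianReal 0 1
  have hsymm : ν.real (Ici (-z)) = ν.real (Iic z) := by
    have hneg : ν.map (fun x => -x) = ν := by simp [ν, gaussianReal_map_neg]
    conv_lhs => rw [← hneg]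
    rw [map_measureReal_apply measurable_neg measurableSet_Ici]
    congr 1
    ext x; simp
  have hpos : 0 < ν.real (Ioo z (-z)) := by
    refine ENNReal.toReal_pos (fun h => ?_) (measure_ne_top _ _)
    have := gaussianReal_absolutelyContinuous' 0 one_ne_zero h
    simp only [Real.volume_Ioo, ENNReal.ofReal_eq_zero, tsub_le_iff_right] at this
    linarith
  have hleft : ν.real (Iic z ∪ Ioo z (-z)) = ν.real (Iic z) + ν.real (Ioo z (-z)) :=
    measureReal_union (disjoint_left.2 fun x hx hy => not_lt.2 hx hy.1) measurableSet_Ioo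
  have htotal : ν.real (Iic z ∪ Ioo z (-z) ∪ Ici (-z))
      = ν.real (Iic z ∪ Ioo z (-z)) + ν.real (Ici (-z)) := by
    refine measureReal_union (disjoint_left.2 fun x hx hy => ?_) measurableSet_Ici
    simp only [mem_union, mem_Iic, mem_Ioo, mem_Ici] at hx hy
    rcases hx with hx | hx <;> linarith [hx, hy]
  have hle : ν.real (Iic z ∪ Ioo z (-z) ∪ Ici (-z)) ≤ 1 := measureReal_le_one
  linarith

theorem stdNormalQuantile_nonneg {p : ℝ} (hp : 1 / 2 ≤ p) (hp1 : p < 1) :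
    0 ≤ stdNormalQuantile p :=
  le_csInf (nonempty_setOf_le_cdf hp1 _) fun _ hz =>
    le_of_not_gt fun hneg => (hp.trans hz).not_gt (cdf_gaussianReal_lt_half hneg)

/-- The `(1 - θ)`-quantile of the normal law with mean `m t` and variance `v t ≥ 0`, as a function
of time; `quantileBound` is the case of the Ornstein–Uhlenbeck mean and variance. -/
noncomputable def normalQuantileBound (m v : ℝ → ℝ) (θ t : ℝ) : ℝ :=
  m t + √(v t) * stdNormalQuantile (1 - θ)

theorem continuousOn_normalQuantileBound {m v : ℝ → ℝ} {A : Set ℝ} (hm : ContinuousOn m A)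
    (hv : ContinuousOn v A) (θ : ℝ) : ContinuousOn (normalQuantileBound m v θ) A :=
  hm.add (hv.sqrt.mul continuousOn_const)

theorem le_normalQuantileBound {θ : ℝ} (hθ0 : 0 < θ) (hθ : θ ≤ 1 / 2) (m v : ℝ → ℝ) (t : ℝ) :
    m t ≤ normalQuantileBound m v θ t :=
  le_add_of_nonneg_right <| mul_nonneg (Real.sqrt_nonneg _) <|
    stdNormalQuantile_nonneg (by linarith) (by linarith)

theorem gaussianReal_eq_map_stdNormal (m v : ℝ) :
    gaussianReal m v.toNNReal = (gaussianReal 0 1).map (fun x => m + √v * x) := by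
  have hcomp : (fun x => m + √v * x) = (fun x => m + x) ∘ (fun x => √v * x) := rfl
  rw [hcomp, ← Measure.map_map (by fun_prop) (by fun_prop), gaussianReal_map_const_mul,
    gaussianReal_map_const_add, mul_zero, zero_add, mul_one]
  congr 1
  ext
  simp [Real.sq_sqrt']

variable {Ω : Type*} [MeasurableSpace Ω] {P : Measure Ω} {X : Ω → ℝ}

theorem measure_le_eq_stdNormal {m v : ℝ} (hX : HasLaw X (gaussianReal m v.toNNReal) P) (c : ℝ) :
    P {w | X w ≤ c} = gaussianReal 0 1 {x | m + √v * x ≤ c} := by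
  have hlaw := hX.map_eq
  rw [gaussianReal_eq_map_stdNormal] at hlaw
  have hIic : P.map X (Iic c) = (gaussianReal 0 1).map (fun x => m + √v * x) (Iic c) := by rw [hlaw]
  rwa [Measure.map_apply_of_aemeasurable hX.aemeasurable measurableSet_Iic,
    Measure.map_apply (by fun_prop) measurableSet_Iic] at hIic

theorem ofReal_le_measure_le_iff {m v : ℝ} (hX : HasLaw X (gaussianReal m v.toNNReal) P) {p : ℝ}
    (hp : 0 < p) (hp1 : p < 1) (c : ℝ) :
    ENNReal.ofReal p ≤ P {w | X w ≤ c} ↔ m + √v * stdNormalQuantile p ≤ c := by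
  rw [measure_le_eq_stdNormal hX]
  rcases (Real.sqrt_nonneg v).eq_or_lt' with hv | hv
  · by_cases hmc : m ≤ c <;> simp [hv, hmc, hp, hp1.le]
  · have hset : ∀ x, m + √v * x ≤ c ↔ x ≤ (c - m) / √v := fun x => by
      rw [le_div_iff₀ hv, le_sub_iff_add_le', mul_comm x]
    simp only [hset]
    change _ ≤ gaussianReal 0 1 (Iic _) ↔ _
    rw [← ofReal_cdf, ENNReal.ofReal_le_ofReal_iff (cdf_nonneg _ _),
      ← stdNormalQuantile_le_iff hp hp1]

theorem lintegral_ofReal_sub_sq [IsProbabilityMeasure P] (hX : MemLp X 2 P) (c : ℝ) :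
    ∫⁻ w, ENNReal.ofReal ((c - X w) ^ 2) ∂P = ENNReal.ofReal (Var[X; P] + (c - P[X]) ^ 2) := by
  have hcX : MemLp (fun w => c - X w) 2 P := (memLp_const c).sub hX
  have hvar := variance_eq_sub hcX
  rw [variance_const_sub hX.aestronglyMeasurable,
    integral_sub (integrable_const c) (hX.integrable one_le_two)] at hvar
  rw [← ofReal_integral_eq_lintegral_ofReal hcX.integrable_sq (ae_of_all _ fun _ => sq_nonneg _)]
  simp only [Pi.pow_apply, integral_const, probReal_univ, one_smul] at hvar
  rw [hvar, sub_add_cancel]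

end Quantile

/-- The pathwise Stieltjes integral `∫₀ᵗ f dw` of a smooth integrand against a merely continuous
path, defined through integration by parts. For `w` a Brownian path it is the Wiener integral. -/
noncomputable def pathStieltjes (f w : ℝ → ℝ) (t : ℝ) : ℝ :=
  f t * w t - f 0 * w 0 - ∫ r in (0 : ℝ)..t, deriv f r * w r

section VariationOfConstants

variable {κ y₀ t : ℝ}

theorem hasDerivAt_exp_decay (κ t r : ℝ) :
    HasDerivAt (fun r => Real.exp (-κ * (t - r))) (κ * Real.exp (-κ * (t - r))) r := by
  have h : HasDerivAt (fun r : ℝ => -κ * (t - r)) κ r := by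
    simpa using ((hasDerivAt_id r).const_sub t).const_mul (-κ)
  simpa only [mul_comm] using h.exp

theorem deriv_exp_decay (κ t : ℝ) :
    deriv (fun r => Real.exp (-κ * (t - r))) = fun r => κ * Real.exp (-κ * (t - r)) :=
  funext fun r => (hasDerivAt_exp_decay κ t r).deriv

theorem eq_meanOUP_of_integral_eq {h z : ℝ → ℝ} (hh : IntervalIntegrable h volume 0 t)
    (hz : IntervalIntegrable z volume 0 t)
    (heq : ∀ x ∈ uIcc 0 t, z x = y₀ + ∫ r in (0 : ℝ)..x, κ * (h r - z r)) :
    z t = meanOUP κ y₀ h t := by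
  set f : ℝ → ℝ := fun r => Real.exp (-κ * (t - r)) with hf
  set g : ℝ → ℝ := fun r => κ * (h r - z r)
  have hfc : Continuous f := by fun_prop
  have hgi : IntervalIntegrable g volume 0 t := (hh.sub hz).const_mul κ
  have hfac : AbsolutelyContinuousOnInterval f 0 t :=
    ContDiffOn.absolutelyContinuousOnInterval (by fun_prop)
  have hparts := hfac.integral_deriv_mul_eq_sub
    (hgi.absolutelyContinuousOnInterval_intervalIntegral (c := 0) (by simp))
  have hintegrand : ∫ x in (0 : ℝ)..t, (deriv f x * (∫ r in (0 : ℝ)..x, g r)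
        + f x * deriv (fun x => ∫ r in (0 : ℝ)..x, g r) x)
      = ∫ x in (0 : ℝ)..t, (κ * (f x * h x) - y₀ * deriv f x) := by
    refine intervalIntegral.integral_congr_ae ?_
    filter_upwards [hgi.ae_hasDerivAt_integral] with x hx hxt
    have hx' := uIoc_subset_uIcc hxt
    rw [(hx hx' 0 (by simp)).deriv, deriv_exp_decay, ← sub_eq_iff_eq_add'.2 (heq x hx')]
    ring
  have hfder : IntervalIntegrable (deriv f) volume 0 t := by
    rw [hf, deriv_exp_decay]
    exact Continuous.intervalIntegrable (by fun_prop) _ _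
  rw [hintegrand, intervalIntegral.integral_sub ((hh.continuousOn_mul hfc.continuousOn).const_mul κ)
      (hfder.const_mul y₀), intervalIntegral.integral_const_mul,
    intervalIntegral.integral_const_mul, intervalIntegral.integral_deriv_eq_sub (f := f)
      (fun x _ => (hasDerivAt_exp_decay κ t x).differentiableAt) hfder,
    intervalIntegral.integral_same] at hparts
  have hft : f t = 1 := by simp [hf]
  have hf0 : f 0 = Real.exp (-κ * t) := by simp [hf]
  rw [heq t right_mem_uIcc, meanOUP, ← hf0]
  rw [hft] at hparts
  linear_combination -hparts

theorem eq_meanOUP_add_pathStieltjes {σ : ℝ} {μ y w : ℝ → ℝ}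
    (hμ : IntervalIntegrable μ volume 0 t) (hy : IntervalIntegrable y volume 0 t)
    (hw : IntervalIntegrable w volume 0 t) (hw0 : w 0 = 0)
    (heq : ∀ x ∈ uIcc 0 t, y x = y₀ + (∫ r in (0 : ℝ)..x, κ * (μ r - y r)) + σ * w x) :
    y t = meanOUP κ y₀ μ t + σ * pathStieltjes (fun r => Real.exp (-κ * (t - r))) w t := by
  -- Subtracting `σ w` turns the integral equation into the one without noise.
  have hz : y t - σ * w t = meanOUP κ y₀ (fun r => μ r - σ * w r) t := by
    refine eq_meanOUP_of_integral_eq (z := fun r => y r - σ * w r) (hμ.sub (hw.const_mul σ))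
      (hy.sub (hw.const_mul σ)) fun x hx => ?_
    simp only [sub_sub_sub_cancel_right, heq x hx, add_sub_cancel_right]
  have hfc : ContinuousOn (fun r => Real.exp (-κ * (t - r))) (uIcc 0 t) := by fun_prop
  simp only [meanOUP, mul_sub (Real.exp _), mul_left_comm _ σ] at hz
  rw [intervalIntegral.integral_sub (hμ.continuousOn_mul hfc)
      ((hw.continuousOn_mul hfc).const_mul σ), intervalIntegral.integral_const_mul] at hz
  simp only [pathStieltjes, deriv_exp_decay, mul_assoc κ, intervalIntegral.integral_const_mul,
    sub_self, mul_zero, Real.exp_zero, hw0, meanOUP]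
  linear_combination hz

end VariationOfConstants

section StieltjesSums

variable {f w : ℝ → ℝ}

theorem natCeil_div_eq_of_mem_Ioc {d r : ℝ} {i : ℕ} (hd : 0 < d)
    (hr : r ∈ Ioc (i * d) ((i + 1 : ℕ) * d)) : ⌈r / d⌉₊ = i + 1 := by
  rw [Nat.ceil_eq_iff i.succ_ne_zero, lt_div_iff₀ hd, div_le_iff₀ hd]
  exact hr

theorem integral_deriv_mul_comp_natCeil_cell (hf : ContDiff ℝ 1 f) (w : ℝ → ℝ) {d : ℝ} (hd : 0 < d)
    (i : ℕ) :
    IntervalIntegrable (fun r => deriv f r * w (⌈r / d⌉₊ * d)) volume (i * d) ((i + 1 : ℕ) * d) ∧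
      ∫ r in (i * d)..((i + 1 : ℕ) * d), deriv f r * w (⌈r / d⌉₊ * d)
        = (f ((i + 1 : ℕ) * d) - f (i * d)) * w ((i + 1 : ℕ) * d) := by
  have hle : (i : ℝ) * d ≤ (i + 1 : ℕ) * d := by gcongr; exact i.le_succ
  have hcell : EqOn (fun r => deriv f r * w ((i + 1 : ℕ) * d))
      (fun r => deriv f r * w (⌈r / d⌉₊ * d)) (uIoc (i * d) ((i + 1 : ℕ) * d)) := fun r hr => by
    rw [uIoc_of_le hle] at hr
    simp only [natCeil_div_eq_of_mem_Ioc hd hr]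
  have hderiv : IntervalIntegrable (deriv f) volume (i * d) ((i + 1 : ℕ) * d) :=
    (hf.continuous_deriv le_rfl).intervalIntegrable _ _
  refine ⟨(hderiv.mul_const _).congr hcell, ?_⟩
  rw [← intervalIntegral.integral_congr_ae (ae_of_all _ fun _ hr => hcell hr),
    intervalIntegral.integral_mul_const,
    intervalIntegral.integral_deriv_eq_sub (fun x _ => (hf.differentiable one_ne_zero) x) hderiv]

theorem sum_mul_sub_eq_sub_integral (hf : ContDiff ℝ 1 f) (w : ℝ → ℝ) {d : ℝ} (hd : 0 < d)
    (n : ℕ) :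
    ∑ i ∈ Finset.range n, f (i * d) * (w ((i + 1 : ℕ) * d) - w (i * d))
      = f (n * d) * w (n * d) - f 0 * w 0
        - ∫ r in (0 : ℝ)..n * d, deriv f r * w (⌈r / d⌉₊ * d) := by
  have hcells := intervalIntegral.sum_integral_adjacent_intervals (a := fun i : ℕ => (i : ℝ) * d)
    (n := n) fun i _ => (integral_deriv_mul_comp_natCeil_cell hf w hd i).1
  have htelescope := Finset.sum_range_sub (fun i : ℕ => f (i * d) * w (i * d)) n
  simp only [Nat.cast_zero, zero_mul] at hcells htelescope
  rw [← hcells, ← htelescope, ← Finset.sum_sub_distrib]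
  refine Finset.sum_congr rfl fun i _ => ?_
  rw [(integral_deriv_mul_comp_natCeil_cell hf w hd i).2]
  ring

theorem tendsto_natCeil_div_mul {t r : ℝ} (ht : 0 < t) (hr : 0 ≤ r) :
    Tendsto (fun n : ℕ => (⌈r / (t / n)⌉₊ : ℝ) * (t / n)) atTop (𝓝 r) := by
  have h := ((tendsto_nat_ceil_mul_div_atTop (div_nonneg hr ht.le)).comp
    tendsto_natCast_atTop_atTop).mul_const t
  rw [div_mul_cancel₀ r ht.ne'] at h
  refine h.congr fun n => ?_
  simp only [Function.comp_apply, div_div_eq_mul_div, mul_div_right_comm r]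
  ring

theorem natCeil_div_mul_mem_Icc {t r : ℝ} {n : ℕ} (ht : 0 < t) (hn : n ≠ 0) (hr : r ≤ t) :
    (⌈r / (t / n)⌉₊ : ℝ) * (t / n) ∈ Icc 0 t := by
  have hn0 : (0 : ℝ) < n := by positivity
  have hceil : ⌈r / (t / n)⌉₊ ≤ n := Nat.ceil_le.2 <| by
    rwa [div_le_iff₀ (by positivity), mul_div_cancel₀ _ hn0.ne']
  refine ⟨by positivity, ?_⟩
  calc (⌈r / (t / n)⌉₊ : ℝ) * (t / n) ≤ n * (t / n) := by gcongr
    _ = t := mul_div_cancel₀ _ hn0.ne'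

theorem tendsto_integral_deriv_mul_comp_natCeil (hf : ContDiff ℝ 1 f) (hw : Continuous w) {t : ℝ}
    (ht : 0 < t) :
    Tendsto (fun n : ℕ => ∫ r in (0 : ℝ)..t, deriv f r * w (⌈r / (t / n)⌉₊ * (t / n))) atTop
      (𝓝 (∫ r in (0 : ℝ)..t, deriv f r * w r)) := by
  have hf' : Continuous (deriv f) := hf.continuous_deriv le_rfl
  obtain ⟨C, hC⟩ := (isCompact_Icc (a := (0 : ℝ)) (b := t)).exists_bound_of_continuousOn
    hw.continuousOn
  refine intervalIntegral.tendsto_integral_filter_of_dominated_convergence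
    (fun r => ‖deriv f r‖ * C) (Eventually.of_forall fun n => ?_) ?_
    ((hf'.norm.mul continuous_const).intervalIntegrable _ _) ?_
  · have hceil : Measurable fun r : ℝ => (⌈r / (t / n)⌉₊ : ℝ) * (t / n) := by fun_prop
    exact (hf'.measurable.mul (hw.measurable.comp hceil)).aestronglyMeasurable
  · filter_upwards [eventually_ne_atTop 0] with n hn
    refine ae_of_all _ fun r hr => ?_
    rw [uIoc_of_le ht.le] at hr
    rw [norm_mul]
    gcongr
    exact hC _ (natCeil_div_mul_mem_Icc ht hn hr.2)
  · refine ae_of_all _ fun r hr => ?_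
    rw [uIoc_of_le ht.le] at hr
    exact ((hw.tendsto r).comp (tendsto_natCeil_div_mul ht hr.1.le)).const_mul _

theorem tendsto_sum_pathStieltjes (hf : ContDiff ℝ 1 f) (hw : Continuous w) {t : ℝ} (ht : 0 < t) :
    Tendsto (fun n : ℕ => ∑ i ∈ Finset.range n,
        f (i * (t / n)) * (w ((i + 1 : ℕ) * (t / n)) - w (i * (t / n)))) atTop
      (𝓝 (pathStieltjes f w t)) := by
  refine ((tendsto_integral_deriv_mul_comp_natCeil hf hw ht).const_sub _).congr' ?_
  filter_upwards [eventually_gt_atTop 0] with n hn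
  have hn0 : (0 : ℝ) < n := by positivity
  rw [sum_mul_sub_eq_sub_integral hf w (by positivity) n, mul_div_cancel₀ _ hn0.ne']

end StieltjesSums

section GaussianSums

variable {Ω : Type*} [MeasurableSpace Ω] {P : Measure Ω} [IsProbabilityMeasure P]

theorem hasLaw_sum_gaussianReal {ι : Type*} {X : ι → Ω → ℝ} {m : ι → ℝ} {v : ι → ℝ≥0}
    (hX : iIndepFun X P) (hlaw : ∀ i, HasLaw (X i) (gaussianReal (m i) (v i)) P) (s : Finset ι) :
    HasLaw (∑ i ∈ s, X i) (gaussianReal (∑ i ∈ s, m i) (∑ i ∈ s, v i)) P := by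
  classical
  induction s using Finset.induction_on with
  | empty =>
    simp only [Finset.sum_empty, gaussianReal_zero_var]
    exact ⟨aemeasurable_const, by simp [Pi.zero_def]⟩
  | insert i s hi ih =>
    have hindep : IndepFun (X i) (∑ j ∈ s, X j) P :=
      (hX.indepFun_finsetSum_of_notMem₀ (fun j => (hlaw j).aemeasurable) hi).symm
    simp only [Finset.sum_insert hi]
    exact ⟨(hlaw i).aemeasurable.add ih.aemeasurable,
      gaussianReal_add_gaussianReal_of_indepFun hindep (hlaw i).map_eq ih.map_eq⟩

theorem hasLaw_gaussianReal_of_ae_tendsto {X : ℕ → Ω → ℝ} {X' : Ω → ℝ} {m : ℕ → ℝ} {m' : ℝ}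
    {v : ℕ → ℝ≥0} {v' : ℝ≥0} (hX : ∀ n, HasLaw (X n) (gaussianReal (m n) (v n)) P)
    (hm : Tendsto m atTop (𝓝 m')) (hv : Tendsto v atTop (𝓝 v'))
    (hlim : ∀ᵐ w ∂P, Tendsto (fun n => X n w) atTop (𝓝 (X' w))) :
    HasLaw X' (gaussianReal m' v') P := by
  have hX' : AEMeasurable X' P :=
    aemeasurable_of_tendsto_metrizable_ae atTop (fun n => (hX n).aemeasurable) hlim
  have := Measure.isProbabilityMeasure_map (μ := P) hX'
  refine ⟨hX', Measure.ext_of_charFun (funext fun ξ => ?_)⟩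
  have hdist : TendstoInDistribution X atTop X' (fun _ => P) P :=
    tendstoInDistribution_of_ae_tendsto (fun n => (hX n).aemeasurable) hX' hlim
  have hcharFun : Tendsto (fun n => charFun (P.map (X n)) ξ) atTop (𝓝 (charFun (P.map X') ξ)) :=
    ProbabilityMeasure.tendsto_iff_tendsto_charFun.1 hdist.tendsto ξ
  simp only [(hX _).map_eq] at hcharFun
  refine tendsto_nhds_unique hcharFun ?_
  simp only [charFun_gaussianReal]
  have hmC : Tendsto (fun n => (m n : ℂ)) atTop (𝓝 m') :=
    (Complex.continuous_ofReal.tendsto _).comp hm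
  have hvC : Tendsto (fun n => ((v n : ℝ) : ℂ)) atTop (𝓝 (v' : ℝ)) :=
    (Complex.continuous_ofReal.tendsto _).comp (NNReal.tendsto_coe.2 hv)
  exact (((hmC.const_mul _).mul_const _).sub ((hvC.mul_const _).div_const _)).cexp

end GaussianSums

section WienerIntegral

theorem pathStieltjes_id {f : ℝ → ℝ} (hf : ContDiff ℝ 1 f) (t : ℝ) :
    pathStieltjes f (fun r => r) t = ∫ r in (0 : ℝ)..t, f r := by
  have hparts := intervalIntegral.integral_deriv_mul_eq_sub (a := 0) (b := t) (v := fun r => r)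
    (v' := fun _ => 1) (fun x _ => (hf.differentiable one_ne_zero x).hasDerivAt)
    (fun x _ => hasDerivAt_id x) ((hf.continuous_deriv le_rfl).intervalIntegrable _ _)
    intervalIntegrable_const
  have hcont := hf.continuous
  have hcont' := hf.continuous_deriv le_rfl
  rw [intervalIntegral.integral_add (Continuous.intervalIntegrable (by fun_prop) _ _)
    (Continuous.intervalIntegrable (by fun_prop) _ _)] at hparts
  simp only [mul_one] at hparts
  rw [pathStieltjes, ← hparts, add_sub_cancel_left]

variable {Ω : Type*} [MeasurableSpace Ω] {P : Measure Ω} {W : ℝ≥0 → Ω → ℝ}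

theorem hasLaw_brownian_grid_increment (hW : IsBrownianReal W P) {d : ℝ} (hd : 0 ≤ d) (i : ℕ) :
    HasLaw (W ((i + 1 : ℕ) * d).toNNReal - W (i * d).toNNReal) (gaussianReal 0 d.toNNReal) P := by
  have hdist : nndist ((i + 1 : ℕ) * d).toNNReal.1 (i * d).toNNReal.1 = d.toNNReal := by
    ext
    rw [coe_nndist, NNReal.val_eq_coe, NNReal.val_eq_coe, Real.coe_toNNReal _ (by positivity),
      Real.coe_toNNReal _ (by positivity), Real.coe_toNNReal _ hd, Real.dist_eq, Nat.cast_succ,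
      add_one_mul, add_sub_cancel_left, abs_of_nonneg hd]
  exact hdist ▸ hW.hasLaw_sub _ _

theorem iIndepFun_brownian_grid_increment (hW : IsBrownianReal W P) {d : ℝ} (hd : 0 ≤ d) :
    iIndepFun (fun (i : ℕ) => W ((i + 1 : ℕ) * d).toNNReal - W (i * d).toNNReal) P :=
  hW.hasIndepIncrements.nat (t := fun i : ℕ => (i * d).toNNReal) fun i j hij =>
    Real.toNNReal_mono (by gcongr)

theorem hasLaw_sum_mul_brownian_increment [IsProbabilityMeasure P] (hW : IsBrownianReal W P)
    (f : ℝ → ℝ) {d : ℝ} (hd : 0 ≤ d) (n : ℕ) :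
    HasLaw (fun w => ∑ i ∈ Finset.range n,
        f (i * d) * (W ((i + 1 : ℕ) * d).toNNReal w - W (i * d).toNNReal w))
      (gaussianReal 0 (∑ i ∈ Finset.range n, f (i * d) ^ 2 * ((i + 1 : ℕ) * d - i * d)).toNNReal)
      P := by
  have hlaw := hasLaw_sum_gaussianReal
    ((iIndepFun_brownian_grid_increment hW hd).comp (fun i x => f (i * d) * x)
      fun i => measurable_const_mul _)
    (fun i => gaussianReal_const_mul (hasLaw_brownian_grid_increment hW hd i) (f (i * d)))
    (Finset.range n)
  convert! hlaw using 1
  · ext w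
    simp
  · congr 1
    · simp
    · ext
      rw [Real.coe_toNNReal _ (Finset.sum_nonneg fun i _ => by push_cast; ring_nf; positivity)]
      push_cast [Real.coe_toNNReal d hd]
      exact Finset.sum_congr rfl fun i _ => by ring

theorem hasLaw_pathStieltjes_brownian [IsProbabilityMeasure P] (hW : IsBrownianReal W P)
    {f : ℝ → ℝ} (hf : ContDiff ℝ 1 f) {t : ℝ} (ht : 0 < t) :
    HasLaw (fun w => pathStieltjes f (fun r => W r.toNNReal w) t)
      (gaussianReal 0 (∫ r in (0 : ℝ)..t, f r ^ 2).toNNReal) P := by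
  refine hasLaw_gaussianReal_of_ae_tendsto
    (fun n => hasLaw_sum_mul_brownian_increment hW f (d := t / n) (by positivity) n)
    tendsto_const_nhds ?_ ?_
  · rw [← pathStieltjes_id (hf.pow 2)]
    exact (continuous_real_toNNReal.tendsto _).comp
      (tendsto_sum_pathStieltjes (hf.pow 2) continuous_id ht)
  · filter_upwards [hW.cont] with w hw
    exact tendsto_sum_pathStieltjes hf (hw.comp continuous_real_toNNReal) ht

end WienerIntegral

section OrnsteinUhlenbeck

theorem integral_sq_exp_decay {κ : ℝ} (hκ : κ ≠ 0) (t : ℝ) :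
    ∫ r in (0 : ℝ)..t, Real.exp (-κ * (t - r)) ^ 2 = (1 - Real.exp (-2 * κ * t)) / (2 * κ) := by
  have hsq : ∀ r, Real.exp (-κ * (t - r)) ^ 2
      = 2 * κ * Real.exp (-(2 * κ) * (t - r)) / (2 * κ) := fun r => by
    rw [mul_div_cancel_left₀ _ (by positivity), ← Real.exp_nat_mul]
    congr 1
    push_cast
    ring
  simp only [hsq, intervalIntegral.integral_div]
  rw [intervalIntegral.integral_eq_sub_of_hasDerivAt
    (fun r _ => hasDerivAt_exp_decay (2 * κ) t r)
    (Continuous.intervalIntegrable (by fun_prop) _ _)]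
  simp

variable {Ω : Type*} [MeasurableSpace Ω] {P : Measure Ω} {κ σ y₀ T t : ℝ} {μ : ℝ → ℝ}

theorem IsOUProcess.ae_eq_meanOUP_add {W : ℝ≥0 → Ω → ℝ} (hW : IsBrownianReal W P)
    (hμ : IntegrableOn μ (Icc 0 T)) {Y : ℝ → Ω → ℝ} (hY : IsOUProcess P W κ σ y₀ μ T Y)
    (ht : t ∈ Icc 0 T) :
    Y t =ᵐ[P] fun w => meanOUP κ y₀ μ t
      + σ * pathStieltjes (fun r => Real.exp (-κ * (t - r))) (fun r => W r.toNNReal w) t := by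
  have hsub : uIcc 0 t ⊆ Icc 0 T := uIcc_of_le ht.1 ▸ Icc_subset_Icc_right ht.2
  filter_upwards [hW.cont, hW.eval_zero_ae_eq_zero, hY.continuousOn_path, hY.integral_eq]
    with w hcont hzero hpath heq
  refine eq_meanOUP_add_pathStieltjes (y := fun r => Y r w) (hμ.mono_set hsub).intervalIntegrable
    (hpath.mono hsub).intervalIntegrable
    ((hcont.comp continuous_real_toNNReal).intervalIntegrable _ _) ?_ fun x hx => heq x (hsub hx)
  rw [Real.toNNReal_zero]
  exact hzero

theorem IsOUProcess.hasLaw [IsProbabilityMeasure P] {W : ℝ≥0 → Ω → ℝ} (hW : IsBrownianReal W P)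
    (hκ : κ ≠ 0) (hμ : IntegrableOn μ (Icc 0 T)) {Y : ℝ → Ω → ℝ}
    (hY : IsOUProcess P W κ σ y₀ μ T Y) (ht : t ∈ Ioc 0 T) :
    HasLaw (Y t) (gaussianReal (meanOUP κ y₀ μ t) (varOUP κ σ t).toNNReal) P := by
  have hWiener := hasLaw_pathStieltjes_brownian hW
    (f := fun r => Real.exp (-κ * (t - r))) (by fun_prop) ht.1
  rw [integral_sq_exp_decay hκ] at hWiener
  have hlaw := (gaussianReal_const_add (gaussianReal_const_mul hWiener σ) (meanOUP κ y₀ μ t)).congr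
    (hY.ae_eq_meanOUP_add hW hμ (Ioc_subset_Icc_self ht))
  have hvar : varOUP κ σ t = σ ^ 2 * ((1 - Real.exp (-2 * κ * t)) / (2 * κ)) := by
    rw [varOUP]
    ring
  convert! hlaw using 2
  · simp
  · rw [hvar, Real.toNNReal_mul (sq_nonneg σ)]
    congr 1
    exact Real.toNNReal_of_nonneg _

theorem continuousOn_meanOUP (hμ : IntegrableOn μ (Icc 0 T)) :
    ContinuousOn (meanOUP κ y₀ μ) (Icc 0 T) := by
  rcases lt_or_ge T 0 with hT | hT
  · simp [Icc_eq_empty hT.not_ge]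
  have hfactor : meanOUP κ y₀ μ = fun t => y₀ * Real.exp (-κ * t)
      + κ * (Real.exp (-κ * t) * ∫ r in (0 : ℝ)..t, Real.exp (κ * r) * μ r) := by
    ext t
    rw [meanOUP, ← intervalIntegral.integral_const_mul (Real.exp _)]
    simp only [← mul_assoc, ← Real.exp_add]
    ring_nf
  rw [← uIcc_of_le hT] at hμ ⊢
  have hprimitive : ContinuousOn (fun t => ∫ r in (0 : ℝ)..t, Real.exp (κ * r) * μ r)
      (uIcc 0 T) :=
    intervalIntegral.continuousOn_primitive_interval
      (hμ.continuousOn_mul (by fun_prop) isCompact_uIcc)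
  rw [hfactor]
  fun_prop

theorem continuous_varOUP (κ σ : ℝ) : Continuous (varOUP κ σ) := by
  unfold varOUP
  fun_prop

end OrnsteinUhlenbeck

section CharacteristicCoordinates

theorem measurePreserving_shear (c : ℝ) :
    MeasurePreserving (fun p : ℝ × ℝ => (p.1, p.2 - p.1 / c)) volume volume :=
  MeasurePreserving.skew_product (g := fun x t => t - x / c) (MeasurePreserving.id volume)
    (by fun_prop) (Eventually.of_forall fun x => map_sub_right_eq_self volume (x / c))

theorem setIntegral_eq_integral_shear {R : Set (ℝ × ℝ)} (hR : MeasurableSet R) {f : ℝ × ℝ → ℝ}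
    (hf : IntegrableOn f R) (c : ℝ) :
    ∫ p in R, f p = ∫ τ, ∫ x in {x | (x, τ + x / c) ∈ R}, f (x, τ + x / c) := by
  have hfR : Integrable (R.indicator f) := (integrable_indicator_iff hR).2 hf
  have hsheared : Integrable (fun p : ℝ × ℝ => R.indicator f (p.1, p.2 + p.1 / c)) := by
    simpa only [Function.comp_def, div_neg, sub_neg_eq_add] using
      (measurePreserving_shear (-c)).integrable_comp_of_integrable hfR
  calc ∫ p in R, f p = ∫ x, ∫ t, R.indicator f (x, t) := by
        rw [← integral_indicator hR, Measure.volume_eq_prod, integral_prod _ hfR]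
    _ = ∫ x, ∫ τ, R.indicator f (x, τ + x / c) := by
        congr 1 with x
        exact (integral_add_right_eq_self (fun t => R.indicator f (x, t)) (x / c)).symm
    _ = ∫ τ, ∫ x, R.indicator f (x, τ + x / c) := integral_integral_swap hsheared
    _ = _ := by
        congr 1 with τ
        have hline : Measurable fun x : ℝ => (x, τ + x / c) := by fun_prop
        exact integral_indicator (hline hR)

variable {c b T : ℝ}

theorem setOf_characteristic_mem_rectangle (hc : 0 < c) (τ : ℝ) :
    {x | (x, τ + x / c) ∈ Icc 0 b ×ˢ Icc 0 T}
      = Icc (max 0 (-(c * τ))) (min b (c * (T - τ))) := by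
  ext x
  have hlower : 0 ≤ τ + x / c ↔ -(c * τ) ≤ x := by
    rw [← neg_le_iff_add_nonneg', le_div_iff₀ hc, neg_mul, mul_comm]
  have hupper : τ + x / c ≤ T ↔ x ≤ c * (T - τ) := by
    rw [← le_sub_iff_add_le', div_le_iff₀' hc]
  simp only [mem_ofPred_eq, mem_prod, mem_Icc, hlower, hupper, max_le_iff, le_min_iff]
  tauto

theorem setIntegral_rectangle_eq_integral_characteristics (hc : 0 < c) (hb : 0 ≤ b) (hT : 0 ≤ T)
    {f : ℝ × ℝ → ℝ} (hf : IntegrableOn f (Icc 0 b ×ˢ Icc 0 T)) (hfT : ∀ p, T ≤ p.2 → f p = 0) :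
    ∫ p in Icc 0 b ×ˢ Icc 0 T, f p
      = ∫ τ in -(b / c)..T, ∫ x in max 0 (-(c * τ))..b, f (x, τ + x / c) := by
  have hbc : 0 ≤ b / c := by positivity
  rw [setIntegral_eq_integral_shear (measurableSet_Icc.prod measurableSet_Icc) hf c,
    intervalIntegral.integral_of_le (by linarith), ← integral_Icc_eq_integral_Ioc]
  simp only [setOf_characteristic_mem_rectangle hc]
  rw [← setIntegral_eq_integral_of_forall_compl_eq_zero (s := Icc (-(b / c)) T) fun τ hτ => ?_]
  · refine setIntegral_congr_fun measurableSet_Icc fun τ hτ => ?_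
    have hle : max 0 (-(c * τ)) ≤ b :=
      max_le hb (by rw [neg_le, ← div_le_iff₀' hc, neg_div]; exact hτ.1)
    rw [intervalIntegral.integral_of_le hle, ← integral_Icc_eq_integral_Ioc]
    refine (setIntegral_eq_of_subset_of_forall_sdiff_eq_zero measurableSet_Icc
      (Icc_subset_Icc_right (min_le_left _ _)) fun x hx => hfT _ ?_).symm
    have hxT : c * (T - τ) < x := by
      by_contra! h
      exact hx.2 ⟨hx.1.1, le_min hx.1.2 h⟩
    rw [← sub_le_iff_le_add', le_div_iff₀' hc]
    exact hxT.le
  · rw [Icc_eq_empty, setIntegral_empty]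
    simp only [mem_Icc, not_and_or, not_le, max_le_iff, le_min_iff] at hτ ⊢
    rcases hτ with h | h
    · rw [lt_neg, div_lt_iff₀' hc, mul_neg] at h
      exact .inl (.inr h)
    · exact .inr (.inl (mul_neg_of_pos_of_neg hc (sub_neg.2 h)))

theorem integrableOn_comp_shear (hc : 0 < c) {G : ℝ → ℝ}
    (hG : IntegrableOn G (Icc (-(b / c)) T)) :
    IntegrableOn (fun p : ℝ × ℝ => G (p.2 - p.1 / c)) (Icc 0 b ×ˢ Icc 0 T) := by
  have hprod : Integrable fun p : ℝ × ℝ =>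
      (Icc 0 b).indicator 1 p.1 * (Icc (-(b / c)) T).indicator G p.2 :=
    ((integrable_indicator_iff measurableSet_Icc).2
      (integrableOn_const (by simp))).mul_prod ((integrable_indicator_iff measurableSet_Icc).2 hG)
  refine ((measurePreserving_shear c).integrable_comp_of_integrable hprod).integrableOn.congr_fun
    (fun p hp => ?_) (measurableSet_Icc.prod measurableSet_Icc)
  have hmem : p.2 - p.1 / c ∈ Icc (-(b / c)) T := by
    have hle : p.1 / c ≤ b / c := by gcongr; exact hp.1.2
    have hnonneg : 0 ≤ p.1 / c := div_nonneg hp.1.1 hc.le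
    constructor <;> linarith [hp.2.1, hp.2.2]
  simp [indicator_of_mem hp.1, indicator_of_mem hmem]

end CharacteristicCoordinates

/-- The formal adjoint `φ ↦ ∂ₜφ + lam ∂ₓφ + s φ` of the advection operator, as it appears in the
weak formulation; points of the plane are pairs `(x, t)`. -/
noncomputable def adjointTransport (lam s : ℝ) (φ : ℝ × ℝ → ℝ) (p : ℝ × ℝ) : ℝ :=
  fderiv ℝ φ p (0, 1) + lam * fderiv ℝ φ p (1, 0) + s * φ p

section AdjointTransport

variable {lam s : ℝ} {φ : ℝ × ℝ → ℝ}

theorem continuous_adjointTransport (hφ : ContDiff ℝ 1 φ) :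
    Continuous (adjointTransport lam s φ) := by
  have hφ' := hφ.continuous_fderiv one_ne_zero
  exact ((hφ'.clm_apply continuous_const).add
    ((hφ'.clm_apply continuous_const).const_mul lam)).add (hφ.continuous.const_mul s)

theorem adjointTransport_eq_zero_of_notMem_tsupport {p : ℝ × ℝ} (hp : p ∉ tsupport φ) :
    adjointTransport lam s φ p = 0 := by
  have hderiv : fderiv ℝ φ p = 0 :=
    image_eq_zero_of_notMem_tsupport fun h => hp (tsupport_fderiv_subset ℝ h)
  simp [adjointTransport, hderiv, image_eq_zero_of_notMem_tsupport hp]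

theorem hasDerivAt_along_characteristic (hlam : lam ≠ 0) (hφ : Differentiable ℝ φ) (τ x : ℝ) :
    HasDerivAt (fun x => lam * (Real.exp (s * x / lam) * φ (x, τ + x / lam)))
      (Real.exp (s * x / lam) * adjointTransport lam s φ (x, τ + x / lam)) x := by
  have hexp : HasDerivAt (fun x : ℝ => Real.exp (s * x / lam))
      (Real.exp (s * x / lam) * (s / lam)) x := by
    simpa using (((hasDerivAt_id x).const_mul s).div_const lam).exp
  have hline : HasDerivAt (fun x : ℝ => (x, τ + x / lam)) ((1 : ℝ), 1 / lam) x :=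
    (hasDerivAt_id x).prodMk (((hasDerivAt_id x).div_const lam).const_add τ)
  have hφline := (hφ (x, τ + x / lam)).hasFDerivAt.comp_hasDerivAt x hline
  have hdirection : ((1 : ℝ), 1 / lam) = ((1 : ℝ), (0 : ℝ)) + (1 / lam) • ((0 : ℝ), (1 : ℝ)) := by
    simp
  rw [hdirection, map_add, map_smul, smul_eq_mul] at hφline
  convert! (hexp.mul hφline).const_mul lam using 1
  simp only [Function.comp_apply, adjointTransport]
  field_simp
  ring

theorem integral_adjointTransport_along_characteristic (hlam : lam ≠ 0) (hφ : ContDiff ℝ 1 φ)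
    (τ x₀ x₁ : ℝ) :
    ∫ x in x₀..x₁, Real.exp (s * x / lam) * adjointTransport lam s φ (x, τ + x / lam)
      = lam * (Real.exp (s * x₁ / lam) * φ (x₁, τ + x₁ / lam)
        - Real.exp (s * x₀ / lam) * φ (x₀, τ + x₀ / lam)) := by
  have hcont := continuous_adjointTransport (lam := lam) (s := s) hφ
  rw [intervalIntegral.integral_eq_sub_of_hasDerivAt
    (fun x _ => hasDerivAt_along_characteristic hlam (hφ.differentiable one_ne_zero) τ x)
    (Continuous.intervalIntegrable (by fun_prop) _ _), mul_sub]

end AdjointTransport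

/-- The value `ρ(0, τ)` carried by the characteristic that crosses `x = 0` at time `τ`, that is,
the boundary datum extended to times `τ < 0` by following the initial datum back along
characteristics. -/
noncomputable def characteristicProfile (lam s : ℝ) (ρ₀ u : ℝ → ℝ) (τ : ℝ) : ℝ :=
  if τ < 0 then Real.exp (s * τ) * ρ₀ (-(lam * τ)) else u τ

/-- The solution of the advection equation given by the method of characteristics. -/
noncomputable def characteristicDensity (lam s : ℝ) (ρ₀ u : ℝ → ℝ) (p : ℝ × ℝ) : ℝ :=
  Real.exp (s * p.1 / lam) * characteristicProfile lam s ρ₀ u (p.2 - p.1 / lam)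

section CharacteristicSolution

variable {lam s b T : ℝ} {ρ₀ u : ℝ → ℝ}

theorem characteristicDensity_along_characteristic (x τ : ℝ) :
    characteristicDensity lam s ρ₀ u (x, τ + x / lam)
      = Real.exp (s * x / lam) * characteristicProfile lam s ρ₀ u τ := by
  rw [characteristicDensity, add_sub_cancel_right]

theorem characteristicDensity_of_lt (hlam : 0 < lam) {x t : ℝ} (h : t < x / lam) :
    characteristicDensity lam s ρ₀ u (x, t) = Real.exp (s * t) * ρ₀ (x - lam * t) := by
  rw [characteristicDensity, characteristicProfile, if_pos (sub_neg.2 h), ← mul_assoc,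
    ← Real.exp_add]
  congr 2 <;> field_simp <;> ring

theorem characteristicDensity_of_le {x t : ℝ} (h : x / lam ≤ t) :
    characteristicDensity lam s ρ₀ u (x, t) = Real.exp (s * x / lam) * u (t - x / lam) := by
  rw [characteristicDensity, characteristicProfile, if_neg (sub_nonneg.2 h).not_gt]

theorem intervalIntegrable_characteristicProfile (hlam : 0 < lam) (hb : 0 ≤ b) (hT : 0 ≤ T)
    (hρ₀ : IntegrableOn ρ₀ (Icc 0 b)) (hu : IntegrableOn u (Icc 0 T)) :
    IntervalIntegrable (characteristicProfile lam s ρ₀ u) volume (-(b / lam)) T := by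
  have hbl : 0 ≤ b / lam := div_nonneg hb hlam.le
  have hinitial : IntervalIntegrable (fun τ => ρ₀ (-(lam * τ))) volume (-(b / lam)) 0 := by
    have hρ₀' : IntervalIntegrable ρ₀ volume b 0 :=
      ((intervalIntegrable_iff_integrableOn_Icc_of_le hb).2 hρ₀).symm
    simpa only [neg_mul, div_neg, zero_div, neg_zero] using hρ₀'.comp_mul_left (c := -lam)
  have hexp : ContinuousOn (fun τ => Real.exp (s * τ)) (uIcc (-(b / lam)) 0) := by fun_prop
  refine IntervalIntegrable.trans (b := 0)
    ((hinitial.continuousOn_mul hexp).congr_uIoo fun τ hτ => ?_)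
    (((intervalIntegrable_iff_integrableOn_Icc_of_le hT).2 hu).congr_uIoo fun τ hτ => ?_)
  · rw [uIoo_of_le (by linarith)] at hτ
    exact (if_pos hτ.2).symm
  · rw [uIoo_of_le hT] at hτ
    exact (if_neg hτ.1.not_gt).symm

theorem integrableOn_characteristicDensity (hlam : 0 < lam) (hb : 0 ≤ b) (hT : 0 ≤ T)
    (hρ₀ : IntegrableOn ρ₀ (Icc 0 b)) (hu : IntegrableOn u (Icc 0 T)) :
    IntegrableOn (characteristicDensity lam s ρ₀ u) (Icc 0 b ×ˢ Icc 0 T) := by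
  have hbl : 0 ≤ b / lam := div_nonneg hb hlam.le
  have hprofile : IntegrableOn (characteristicProfile lam s ρ₀ u) (Icc (-(b / lam)) T) :=
    (intervalIntegrable_iff_integrableOn_Icc_of_le (by linarith)).1
      (intervalIntegrable_characteristicProfile hlam hb hT hρ₀ hu)
  exact (integrableOn_comp_shear hlam hprofile).continuousOn_mul
    (g := fun p : ℝ × ℝ => Real.exp (s * p.1 / lam)) (by fun_prop)
    (isCompact_Icc.prod isCompact_Icc)

theorem integrableOn_characteristicDensity_outflow (hlam : 0 < lam) (hb : 0 ≤ b) (hT : 0 ≤ T)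
    (hρ₀ : IntegrableOn ρ₀ (Icc 0 b)) (hu : IntegrableOn u (Icc 0 T)) :
    IntegrableOn (fun t => characteristicDensity lam s ρ₀ u (b, t)) (Icc 0 T) := by
  have hbl : 0 ≤ b / lam := div_nonneg hb hlam.le
  have hprofile := (intervalIntegrable_characteristicProfile (s := s) hlam hb hT hρ₀
    hu).comp_sub_right (b / lam)
  rw [neg_add_cancel,
    intervalIntegrable_iff_integrableOn_Icc_of_le (by linarith : 0 ≤ T + b / lam)] at hprofile
  have hsub : Icc 0 T ⊆ Icc 0 (T + b / lam) := Icc_subset_Icc_right (by linarith)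
  simp only [characteristicDensity]
  exact (hprofile.mono_set hsub).const_mul (Real.exp (s * b / lam))

variable {φ : ℝ × ℝ → ℝ}

-- The characteristic that crosses `x = 0` at time `τ` enters the rectangle at
-- `(max 0 (-(lam * τ)), max τ 0)` and leaves it at `x = b`, or at `t = T`, where `φ` vanishes.
theorem integral_characteristicDensity_mul_adjointTransport (hlam : 0 < lam) (hb : 0 ≤ b)
    (hT : 0 ≤ T) (hρ₀ : IntegrableOn ρ₀ (Icc 0 b)) (hu : IntegrableOn u (Icc 0 T))
    (hφ : ContDiff ℝ 1 φ) (hφT : tsupport φ ⊆ {p | p.2 < T}) :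
    ∫ p in Icc 0 b ×ˢ Icc 0 T,
        characteristicDensity lam s ρ₀ u p * adjointTransport lam s φ p
      = lam * ((∫ τ in -(b / lam)..T, characteristicDensity lam s ρ₀ u (b, τ + b / lam)
            * φ (b, τ + b / lam))
          - ∫ τ in -(b / lam)..T, characteristicDensity lam s ρ₀ u (max 0 (-(lam * τ)), max τ 0)
            * φ (max 0 (-(lam * τ)), max τ 0)) := by
  have hφc := hφ.continuous
  have hprofile := intervalIntegrable_characteristicProfile (s := s) hlam hb hT hρ₀ hu
  have hint := (integrableOn_characteristicDensity (s := s) hlam hb hT hρ₀ hu).mul_continuousOn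
    (continuous_adjointTransport (lam := lam) (s := s) hφ).continuousOn
    (isCompact_Icc.prod isCompact_Icc)
  have hvanish (p : ℝ × ℝ) (hp : T ≤ p.2) :
      characteristicDensity lam s ρ₀ u p * adjointTransport lam s φ p = 0 := by
    rw [adjointTransport_eq_zero_of_notMem_tsupport fun h => hp.not_gt (hφT h), mul_zero]
  have hproduct {e : ℝ → ℝ} (he : Continuous e) : IntervalIntegrable (fun τ =>
      characteristicDensity lam s ρ₀ u (e τ, τ + e τ / lam) * φ (e τ, τ + e τ / lam))
      volume (-(b / lam)) T := by
    simp only [characteristicDensity_along_characteristic]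
    exact (hprofile.continuousOn_mul (by fun_prop)).mul_continuousOn (by fun_prop)
  have hentry (τ : ℝ) : max τ 0 = τ + max 0 (-(lam * τ)) / lam := by
    rw [← max_div_div_right hlam.le, zero_div, neg_div, mul_div_cancel_left₀ _ hlam.ne',
      ← max_add_add_left, add_zero, add_neg_cancel]
  simp only [hentry]
  rw [setIntegral_rectangle_eq_integral_characteristics hlam hb hT hint hvanish,
    ← intervalIntegral.integral_sub (hproduct continuous_const) (hproduct (by fun_prop)),
    ← intervalIntegral.integral_const_mul]
  congr 1 with τ
  simp only [characteristicDensity_along_characteristic,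
    mul_right_comm _ (characteristicProfile lam s ρ₀ u τ)]
  rw [intervalIntegral.integral_mul_const,
    integral_adjointTransport_along_characteristic hlam.ne' hφ]
  ring

theorem intervalIntegral_comp_add_eq_setIntegral {f : ℝ → ℝ} {d : ℝ} (hd : 0 ≤ d) (hT : 0 ≤ T)
    (hf : ∀ t, T ≤ t → f t = 0) : ∫ τ in -d..T, f (τ + d) = ∫ t in Icc 0 T, f t := by
  rw [intervalIntegral.integral_comp_add_right, neg_add_cancel,
    intervalIntegral.integral_of_le (by linarith), ← integral_Icc_eq_integral_Ioc]
  exact setIntegral_eq_of_subset_of_forall_sdiff_eq_zero measurableSet_Icc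
    (Icc_subset_Icc_right (by linarith)) fun t ht =>
      hf t (le_of_not_ge fun h => ht.2 ⟨ht.1.1, h⟩)

theorem characteristicDensity_entry_of_neg (hlam : 0 < lam) {τ : ℝ} (hτ : τ < 0) :
    characteristicDensity lam s ρ₀ u (-(lam * τ), 0) = ρ₀ (-(lam * τ)) := by
  have hpos : 0 < -(lam * τ) / lam := div_pos (neg_pos.2 (mul_neg_of_pos_of_neg hlam hτ)) hlam
  rw [characteristicDensity_of_lt hlam hpos, mul_zero, Real.exp_zero, one_mul, mul_zero, sub_zero]

theorem characteristicDensity_inflow {t : ℝ} (ht : 0 ≤ t) :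
    characteristicDensity lam s ρ₀ u (0, t) = u t := by
  rw [characteristicDensity_of_le (by rwa [zero_div]), mul_zero, zero_div, Real.exp_zero, one_mul,
    sub_zero]

theorem integral_characteristicDensity_mul_entry (hlam : 0 < lam) (hb : 0 ≤ b) (hT : 0 ≤ T)
    (hρ₀ : IntegrableOn ρ₀ (Icc 0 b)) (hu : IntegrableOn u (Icc 0 T)) (hφ : Continuous φ) :
    lam * ∫ τ in -(b / lam)..T, characteristicDensity lam s ρ₀ u (max 0 (-(lam * τ)), max τ 0)
        * φ (max 0 (-(lam * τ)), max τ 0)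
      = (∫ x in Icc 0 b, ρ₀ x * φ (x, 0)) + lam * ∫ t in Icc 0 T, u t * φ (0, t) := by
  have hbl : 0 ≤ b / lam := div_nonneg hb hlam.le
  set F : ℝ → ℝ := fun τ => characteristicDensity lam s ρ₀ u (max 0 (-(lam * τ)), max τ 0)
    * φ (max 0 (-(lam * τ)), max τ 0)
  set R : ℝ → ℝ := fun x => ρ₀ x * φ (x, 0)
  have hR : IntervalIntegrable R volume b 0 :=
    ((intervalIntegrable_iff_integrableOn_Icc_of_le hb).2
      (hρ₀.mul_continuousOn (by fun_prop) isCompact_Icc)).symm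
  have hU : IntervalIntegrable (fun t => u t * φ (0, t)) volume 0 T :=
    (intervalIntegrable_iff_integrableOn_Icc_of_le hT).2
      (hu.mul_continuousOn (by fun_prop) isCompact_Icc)
  have hneg : EqOn (fun τ => R (-lam * τ)) F (uIoo (-(b / lam)) 0) := fun τ hτ => by
    rw [uIoo_of_le (by linarith)] at hτ
    have hlamτ : 0 ≤ -(lam * τ) := neg_nonneg.2 (mul_nonpos_of_nonneg_of_nonpos hlam.le hτ.2.le)
    simp only [F, R, neg_mul, max_eq_right hlamτ, max_eq_right hτ.2.le,
      characteristicDensity_entry_of_neg hlam hτ.2]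
  have hnonneg : EqOn (fun t => u t * φ (0, t)) F (uIoo 0 T) := fun t ht => by
    rw [uIoo_of_le hT] at ht
    have hlamt : -(lam * t) ≤ 0 := neg_nonpos.2 (mul_nonneg hlam.le ht.1.le)
    simp only [F, max_eq_left hlamt, max_eq_left ht.1.le, characteristicDensity_inflow ht.1.le]
  have hRneg : IntervalIntegrable (fun τ => R (-lam * τ)) volume (-(b / lam)) 0 := by
    simpa only [div_neg, zero_div, neg_zero] using hR.comp_mul_left (c := -lam)
  rw [← intervalIntegral.integral_add_adjacent_intervals (hRneg.congr_uIoo hneg)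
    (hU.congr_uIoo hnonneg), mul_add, integral_Icc_eq_integral_Ioc, integral_Icc_eq_integral_Ioc,
    ← intervalIntegral.integral_of_le hb, ← intervalIntegral.integral_of_le hT,
    ← intervalIntegral.integral_congr_uIoo hneg, ← intervalIntegral.integral_congr_uIoo hnonneg,
    intervalIntegral.integral_comp_mul_left _ (neg_ne_zero.2 hlam.ne')]
  congr 1
  rw [neg_mul_neg, mul_div_cancel₀ _ hlam.ne', mul_zero, intervalIntegral.integral_symm,
    smul_eq_mul, inv_neg, neg_mul_neg, mul_inv_cancel_left₀ hlam.ne']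

theorem isWeakSolution_characteristicDensity (hlam : 0 < lam) (hb : 0 ≤ b) (hT : 0 ≤ T)
    (hρ₀ : IntegrableOn ρ₀ (Icc 0 b)) (hu : IntegrableOn u (Icc 0 T)) :
    IsWeakSolution lam s b T ρ₀ u (characteristicDensity lam s ρ₀ u)
      (fun t => characteristicDensity lam s ρ₀ u (b, t)) where
  integrableOn_density := integrableOn_characteristicDensity hlam hb hT hρ₀ hu
  integrableOn_outflow := integrableOn_characteristicDensity_outflow hlam hb hT hρ₀ hu
  weak_form φ hφ _ hφT := by
    have hvanish (t : ℝ) (ht : T ≤ t) :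
        characteristicDensity lam s ρ₀ u (b, t) * φ (b, t) = 0 := by
      rw [image_eq_zero_of_notMem_tsupport fun h => ht.not_gt (hφT h), mul_zero]
    have hinterior := integral_characteristicDensity_mul_adjointTransport (s := s) hlam hb hT hρ₀
      hu (hφ.of_le (by simp)) hφT
    rw [intervalIntegral_comp_add_eq_setIntegral (div_nonneg hb hlam.le) hT hvanish, mul_sub,
      integral_characteristicDensity_mul_entry hlam hb hT hρ₀ hu hφ.continuous] at hinterior
    simp only [adjointTransport] at hinterior
    linarith

end CharacteristicSolution

/-- The test function that carries the outflow profile `g` from `x = b` back along characteristics,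
cut off in space by `χ`. -/
noncomputable def outflowTest (lam s b : ℝ) (χ g : ℝ → ℝ) (p : ℝ × ℝ) : ℝ :=
  χ p.1 * (Real.exp (s * (b - p.1) / lam) * g (p.2 + (b - p.1) / lam))

section OutflowTest

variable {lam s b : ℝ} {χ g : ℝ → ℝ}

theorem contDiff_outflowTest (hχ : ContDiff ℝ (⊤ : ℕ∞) χ) (hg : ContDiff ℝ (⊤ : ℕ∞) g) :
    ContDiff ℝ (⊤ : ℕ∞) (outflowTest lam s b χ g) := by
  unfold outflowTest
  fun_prop

theorem outflowTest_outflow (hχ : χ b = 1) (t : ℝ) : outflowTest lam s b χ g (b, t) = g t := by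
  simp [outflowTest, hχ]

theorem adjointTransport_outflowTest (hlam : lam ≠ 0) (hχ : ContDiff ℝ (⊤ : ℕ∞) χ)
    (hg : ContDiff ℝ (⊤ : ℕ∞) g) {p : ℝ × ℝ} (hp : χ =ᶠ[𝓝 p.1] 1) :
    adjointTransport lam s (outflowTest lam s b χ g) p = 0 := by
  set τ := p.2 - p.1 / lam
  have hconst : (fun x => lam * (Real.exp (s * x / lam)
      * outflowTest lam s b χ g (x, τ + x / lam))) =ᶠ[𝓝 p.1]
      fun _ => lam * (Real.exp (s * b / lam) * g (τ + b / lam)) := by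
    filter_upwards [hp] with x hx
    have hexp : Real.exp (s * b / lam)
        = Real.exp (s * x / lam) * Real.exp (s * (b - x) / lam) := by
      rw [← Real.exp_add]
      ring_nf
    have hdelay : τ + x / lam + (b - x) / lam = τ + b / lam := by ring
    simp only [outflowTest, hx, Pi.one_apply, one_mul, hexp, hdelay, mul_assoc]
  have hderiv := (hasDerivAt_along_characteristic (s := s) hlam
    ((contDiff_outflowTest hχ hg).differentiable (by simp)) τ p.1).unique
      ((hasDerivAt_const p.1 _).congr_of_eventuallyEq hconst)
  simpa only [mul_eq_zero, Real.exp_ne_zero, false_or, τ, sub_add_cancel] using hderiv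

theorem support_outflowTest_subset : Function.support (outflowTest lam s b χ g) ⊆
    (fun q : ℝ × ℝ => (q.1, q.2 + (q.1 - b) / lam)) '' (tsupport χ ×ˢ tsupport g) := by
  intro p hp
  refine ⟨(p.1, p.2 + (b - p.1) / lam), ⟨subset_tsupport _ (left_ne_zero_of_mul hp),
    subset_tsupport _ (right_ne_zero_of_mul (right_ne_zero_of_mul hp))⟩, ?_⟩
  ext <;> simp only
  ring

theorem exists_contDiff_adjointTransport_eq_zero {T : ℝ} (hlam : 0 < lam) (hb : 0 ≤ b)
    (hg : ContDiff ℝ (⊤ : ℕ∞) g) (hgc : HasCompactSupport g) (hgT : tsupport g ⊆ Iio T) :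
    ∃ φ : ℝ × ℝ → ℝ, ContDiff ℝ (⊤ : ℕ∞) φ ∧ HasCompactSupport φ ∧
      tsupport φ ⊆ {p | p.2 < T} ∧ (∀ t, φ (b, t) = g t) ∧
      ∀ p : ℝ × ℝ, p.1 ∈ Icc 0 b → adjointTransport lam s φ p = 0 := by
  -- Cutting off at a distance `lam * δ` beyond `b` delays the support in time by at most `δ`.
  obtain ⟨δ, hδ, hδT⟩ := hgc.isCompact.exists_cthickening_subset_open isOpen_Iio hgT
  have hlamδ : 0 < lam * δ := mul_pos hlam hδ
  let χ : ContDiffBump (b / 2) := ⟨b / 2 + lam * δ / 2, b / 2 + lam * δ, by positivity, by linarith⟩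
  have hχ : ∀ x ∈ Icc 0 b, χ =ᶠ[𝓝 x] 1 := fun x hx => by
    refine χ.eventuallyEq_one_of_mem_ball ?_
    rw [Metric.mem_ball, Real.dist_eq, abs_lt]
    constructor <;> simp only [χ] <;> linarith [hx.1, hx.2]
  set Z := (fun q : ℝ × ℝ => (q.1, q.2 + (q.1 - b) / lam)) '' (tsupport χ ×ˢ tsupport g)
  have hZ : IsCompact Z := (χ.hasCompactSupport.isCompact.prod hgc.isCompact).image (by fun_prop)
  have hZT : Z ⊆ {p | p.2 < T} := by
    rintro _ ⟨⟨x, τ⟩, ⟨hx, hτ⟩, rfl⟩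
    have hxδ : (x - b) / lam ≤ δ := by
      rw [χ.tsupport_eq, Metric.mem_closedBall, Real.dist_eq] at hx
      rw [div_le_iff₀' hlam]
      have := (abs_le.1 hx).2
      simp only [χ] at this
      linarith
    have hτδ : τ + δ < T := hδT (Metric.mem_cthickening_of_dist_le _ τ _ _ hτ
      (by rw [Real.dist_eq, add_sub_cancel_left, abs_of_pos hδ]))
    exact (add_le_add_right hxδ τ).trans_lt hτδ
  exact ⟨outflowTest lam s b χ g, contDiff_outflowTest χ.contDiff hg,
    .of_support_subset_isCompact hZ support_outflowTest_subset,
    (closure_minimal support_outflowTest_subset hZ.isClosed).trans hZT,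
    outflowTest_outflow (hχ b ⟨hb, le_rfl⟩).self_of_nhds,
    fun p hp => adjointTransport_outflowTest hlam.ne' χ.contDiff hg (hχ p.1 hp)⟩

end OutflowTest

section Supply

variable {lam s b T : ℝ} {ρ₀ u S S' : ℝ → ℝ} {ρ ρ' : ℝ × ℝ → ℝ}

theorem IsWeakSolution.integral_outflow_eq (h : IsWeakSolution lam s b T ρ₀ u ρ S)
    (h' : IsWeakSolution lam s b T ρ₀ u ρ' S') (hlam : 0 < lam) (hb : 0 ≤ b) {g : ℝ → ℝ}
    (hg : ContDiff ℝ (⊤ : ℕ∞) g) (hgc : HasCompactSupport g) (hgT : tsupport g ⊆ Iio T) :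
    ∫ t in Icc 0 T, S t * g t = ∫ t in Icc 0 T, S' t * g t := by
  obtain ⟨φ, hφ, hφc, hφT, hφb, hφ0⟩ :=
    exists_contDiff_adjointTransport_eq_zero (s := s) hlam hb hg hgc hgT
  have hinterior (r : ℝ × ℝ → ℝ) :
      ∫ p in Icc 0 b ×ˢ Icc 0 T, r p * adjointTransport lam s φ p = 0 :=
    setIntegral_eq_zero_of_forall_eq_zero fun p hp => by rw [hφ0 p hp.1, mul_zero]
  have hweak := h.weak_form φ hφ hφc hφT
  have hweak' := h'.weak_form φ hφ hφc hφT
  simp only [adjointTransport] at hinterior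
  simp only [hinterior, hφb] at hweak hweak'
  exact mul_left_cancel₀ hlam.ne' (by linarith)

theorem IsWeakSolution.outflow_ae_eq (h : IsWeakSolution lam s b T ρ₀ u ρ S)
    (h' : IsWeakSolution lam s b T ρ₀ u ρ' S') (hlam : 0 < lam) (hb : 0 ≤ b) :
    S =ᵐ[volume.restrict (Icc 0 T)] S' := by
  have hint := h.integrableOn_outflow
  have hint' := h'.integrableOn_outflow
  have hdiff : ∀ᵐ t, t ∈ Ioo 0 T → S t - S' t = 0 := by
    refine isOpen_Ioo.ae_eq_zero_of_integral_contDiff_smul_eq_zero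
      ((hint.sub hint').mono_set Ioo_subset_Icc_self).locallyIntegrableOn fun g hg hgc hgs => ?_
    have hmul {f : ℝ → ℝ} (hf : IntegrableOn f (Icc 0 T)) :
        IntegrableOn (fun t => f t * g t) (Icc 0 T) :=
      hf.mul_continuousOn hg.continuous.continuousOn isCompact_Icc
    rw [← setIntegral_eq_integral_of_forall_compl_eq_zero (s := Icc 0 T) fun t ht => ?_]
    · simp only [smul_eq_mul, mul_comm (g _), sub_mul]
      rw [integral_sub (hmul hint) (hmul hint'), sub_eq_zero]
      exact h.integral_outflow_eq h' hlam hb hg hgc fun t ht => (hgs ht).2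
    · rw [image_eq_zero_of_notMem_tsupport fun h => ht (Ioo_subset_Icc_self (hgs h)), zero_smul]
  rw [← restrict_Ioo_eq_restrict_Icc, EventuallyEq, ae_restrict_iff' measurableSet_Ioo]
  exact hdiff.mono fun t ht htI => sub_eq_zero.1 (ht htI)

theorem IsWeakSolution.congr_outflow (h : IsWeakSolution lam s b T ρ₀ u ρ S)
    (hS : S =ᵐ[volume.restrict (Icc 0 T)] S') : IsWeakSolution lam s b T ρ₀ u ρ S' where
  integrableOn_density := h.integrableOn_density
  integrableOn_outflow := h.integrableOn_outflow.congr hS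
  weak_form φ hφ hφc hφT := by
    have hint : ∫ t in Icc 0 T, S t * φ (b, t) = ∫ t in Icc 0 T, S' t * φ (b, t) :=
      integral_congr_ae (hS.mono fun t ht => congrArg (· * φ (b, t)) ht)
    exact hint ▸ h.weak_form φ hφ hφc hφT

theorem isSupply_iff (hlam : 0 < lam) (hb : 0 ≤ b) (hT : 0 ≤ T) (hρ₀ : IntegrableOn ρ₀ (Icc 0 b))
    (hu : IntegrableOn u (Icc 0 T)) :
    IsSupply lam s b T ρ₀ u S ↔
      S =ᵐ[volume.restrict (Icc 0 T)] fun t => characteristicDensity lam s ρ₀ u (b, t) := by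
  have hsol := isWeakSolution_characteristicDensity (s := s) hlam hb hT hρ₀ hu
  exact ⟨fun ⟨_, h⟩ => h.outflow_ae_eq hsol hlam hb, fun h => ⟨_, hsol.congr_outflow h.symm⟩⟩

end Supply

section ChanceConstraint

variable {Ω : Type*} [MeasurableSpace Ω] {P : Measure Ω} [IsProbabilityMeasure P]

theorem exists_ofReal_le_measure_le (X : Ω → ℝ) {p : ℝ} (hp : p < 1) :
    ∃ c : ℝ, ENNReal.ofReal p ≤ P {w | X w ≤ c} := by
  have hmono : Monotone fun n : ℕ => {w | X w ≤ n} :=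
    fun m n hmn w (hw : X w ≤ m) => hw.trans (Nat.cast_le.2 hmn)
  have hcover : ⋃ n : ℕ, {w | X w ≤ n} = univ :=
    eq_univ_of_forall fun w => mem_iUnion.2 (exists_nat_ge (X w))
  have hlim := tendsto_measure_iUnion_atTop (μ := P) hmono
  rw [hcover, measure_univ] at hlim
  obtain ⟨n, hn⟩ := (hlim.eventually_const_le (ENNReal.ofReal_lt_one.2 hp)).exists
  exact ⟨n, hn⟩

theorem exists_ae_eq_singleChanceConstraint {Y : ℝ → Ω → ℝ} {θ : ℝ} (hθ : 0 < θ) {I : Set ℝ}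
    {S : ℝ → ℝ} (hS : ∀ᵐ t, t ∈ I → ENNReal.ofReal (1 - θ) ≤ P {w | Y t w ≤ S t}) :
    ∃ S' : ℝ → ℝ, S' =ᵐ[volume] S ∧ SingleChanceConstraint P Y θ I S' := by
  classical
  choose c hc using fun t =>
    exists_ofReal_le_measure_le (P := P) (Y t) (sub_lt_self (1 : ℝ) hθ)
  refine ⟨fun t => if ENNReal.ofReal (1 - θ) ≤ P {w | Y t w ≤ S t} ∨ t ∉ I then S t else c t,
    hS.mono fun t ht => if_pos (or_iff_not_imp_right.2 fun h => ht (not_not.1 h)), fun t ht => ?_⟩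
  by_cases h : ENNReal.ofReal (1 - θ) ≤ P {w | Y t w ≤ S t}
  · simp only [h, true_or, if_true]
  · simpa only [h, ht, not_true, or_false, if_false] using hc t

end ChanceConstraint

section TrackingCost

variable {Ω : Type*} [MeasurableSpace Ω] {P : Measure Ω} {Y : ℝ → Ω → ℝ} {t₁ T : ℝ}
  {m v q S S' : ℝ → ℝ}

theorem trackingCost_congr (h : S =ᵐ[volume.restrict (Icc t₁ T)] S') :
    trackingCost P Y t₁ T S = trackingCost P Y t₁ T S' :=
  lintegral_congr_ae (h.mono fun t ht => by simp only [ht])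

variable [IsProbabilityMeasure P]

theorem trackingCost_eq
    (hY : ∀ t ∈ Icc t₁ T, HasLaw (Y t) (gaussianReal (m t) (v t).toNNReal) P)
    (S : ℝ → ℝ) :
    trackingCost P Y t₁ T S =
      ∫⁻ t in Icc t₁ T, ENNReal.ofReal ((v t).toNNReal + (S t - m t) ^ 2) := by
  refine setLIntegral_congr_fun measurableSet_Icc fun t ht => ?_
  have hX := hY t ht
  rw [lintegral_ofReal_sub_sq hX.hasGaussianLaw.memLp_two, hX.variance_eq, hX.integral_eq,
    variance_id_gaussianReal]
  simp only [integral_id_gaussianReal]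

theorem trackingCost_ne_top
    (hY : ∀ t ∈ Icc t₁ T, HasLaw (Y t) (gaussianReal (m t) (v t).toNNReal) P)
    (hm : ContinuousOn m (Icc t₁ T)) (hv : ContinuousOn v (Icc t₁ T))
    (hq : ContinuousOn q (Icc t₁ T)) : trackingCost P Y t₁ T q ≠ ∞ := by
  rw [trackingCost_eq hY]
  have hcont : ContinuousOn (fun t => ((v t).toNNReal : ℝ) + (q t - m t) ^ 2) (Icc t₁ T) := by
    fun_prop
  exact hcont.integrableOn_Icc.lintegral_lt_top.ne

theorem trackingCost_mono
    (hY : ∀ t ∈ Icc t₁ T, HasLaw (Y t) (gaussianReal (m t) (v t).toNNReal) P)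
    (hmq : ∀ t ∈ Icc t₁ T, m t ≤ q t) (hqS : ∀ t ∈ Icc t₁ T, q t ≤ S t) :
    trackingCost P Y t₁ T q ≤ trackingCost P Y t₁ T S := by
  rw [trackingCost_eq hY, trackingCost_eq hY]
  refine setLIntegral_mono' measurableSet_Icc fun t ht => ENNReal.ofReal_le_ofReal ?_
  have hmqt := sub_nonneg.2 (hmq t ht)
  have hqSt := hqS t ht
  gcongr

theorem ae_eq_of_trackingCost_le
    (hY : ∀ t ∈ Icc t₁ T, HasLaw (Y t) (gaussianReal (m t) (v t).toNNReal) P)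
    (hm : AEMeasurable m (volume.restrict (Icc t₁ T)))
    (hv : AEMeasurable v (volume.restrict (Icc t₁ T)))
    (hS : AEMeasurable S (volume.restrict (Icc t₁ T))) (hmq : ∀ t ∈ Icc t₁ T, m t ≤ q t)
    (hqS : ∀ t ∈ Icc t₁ T, q t ≤ S t) (hfin : trackingCost P Y t₁ T q ≠ ∞)
    (hle : trackingCost P Y t₁ T S ≤ trackingCost P Y t₁ T q) :
    S =ᵐ[volume.restrict (Icc t₁ T)] q := by
  rw [trackingCost_eq hY] at hfin
  rw [trackingCost_eq hY, trackingCost_eq hY] at hle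
  have hintegrand := ae_eq_of_ae_le_of_lintegral_le
    (f := fun t => ENNReal.ofReal ((v t).toNNReal + (q t - m t) ^ 2))
    (g := fun t => ENNReal.ofReal ((v t).toNNReal + (S t - m t) ^ 2))
    (ae_restrict_of_forall_mem measurableSet_Icc fun t ht => ?_) hfin
    (hv.real_toNNReal.coe_nnreal_real.add ((hS.sub hm).pow_const 2)).ennreal_ofReal hle
  · filter_upwards [hintegrand, ae_restrict_mem measurableSet_Icc] with t ht htI
    have hmqt := sub_nonneg.2 (hmq t htI)
    have hmSt := sub_nonneg.2 ((hmq t htI).trans (hqS t htI))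
    rw [ENNReal.ofReal_eq_ofReal_iff (by positivity) (by positivity), add_right_inj,
      sq_eq_sq₀ hmqt hmSt] at ht
    exact (sub_left_inj.1 ht).symm
  · have hmqt := sub_nonneg.2 (hmq t ht)
    have hqSt := hqS t ht
    refine ENNReal.ofReal_le_ofReal ?_
    gcongr

end TrackingCost

/-- The inflow whose outflow, after the transport delay `b / lam`, is `q`; the factor
`exp (-(s * b / lam))` undoes the effect of the source term along the edge. -/
noncomputable def inflowProducing (lam s b : ℝ) (q : ℝ → ℝ) (t : ℝ) : ℝ :=
  Real.exp (-(s * b / lam)) * q (t + b / lam)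

section InflowProducing

variable {lam s b T : ℝ} {ρ₀ u q : ℝ → ℝ}

theorem characteristicDensity_outflow_ae_eq_iff :
    (∀ᵐ t ∂(volume.restrict (Icc (b / lam) T)), characteristicDensity lam s ρ₀ u (b, t) = q t) ↔
      ∀ᵐ t ∂(volume.restrict (Icc 0 (T - b / lam))), u t = inflowProducing lam s b q t := by
  rw [ae_restrict_iff' measurableSet_Icc, ae_restrict_iff' measurableSet_Icc]
  conv_lhs => rw [← map_add_right_ae volume (b / lam), eventually_map]
  have hmem (t : ℝ) : t + b / lam ∈ Icc (b / lam) T ↔ t ∈ Icc 0 (T - b / lam) := by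
    rw [mem_Icc, mem_Icc, le_add_iff_nonneg_left, le_sub_iff_add_le]
  refine eventually_congr (.of_forall fun t => ?_)
  rw [hmem]
  refine forall_congr' fun ht => ?_
  rw [characteristicDensity_of_le (le_add_of_nonneg_left ht.1), add_sub_cancel_right,
    inflowProducing, Real.exp_neg, eq_inv_mul_iff_mul_eq₀ (Real.exp_ne_zero _)]

theorem isAdmissible_indicator_inflowProducing (hq : ContinuousOn q (Icc (b / lam) T))
    (hpos : ∀ t ∈ Icc (b / lam) T, 0 ≤ q t) :
    IsAdmissible T ((Icc 0 (T - b / lam)).indicator (inflowProducing lam s b q)) where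
  memLp := by
    have hmaps : MapsTo (· + b / lam) (Icc 0 (T - b / lam)) (Icc (b / lam) T) :=
      fun t ht => ⟨le_add_of_nonneg_left ht.1, le_sub_iff_add_le.1 ht.2⟩
    have hcont : ContinuousOn (inflowProducing lam s b q) (Icc 0 (T - b / lam)) :=
      continuousOn_const.mul (hq.comp (by fun_prop) hmaps)
    obtain ⟨C, hC⟩ := isCompact_Icc.exists_bound_of_continuousOn hcont
    have hmem : MemLp (inflowProducing lam s b q) 2 (volume.restrict (Icc 0 (T - b / lam))) :=
      .of_bound (hcont.aestronglyMeasurable measurableSet_Icc) C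
        (ae_restrict_of_forall_mem measurableSet_Icc hC)
    exact ((memLp_indicator_iff_restrict measurableSet_Icc).2 hmem).restrict _
  nonneg t _ := by
    refine indicator_nonneg (fun τ hτ => mul_nonneg (Real.exp_pos _).le (hpos _ ?_)) t
    exact ⟨le_add_of_nonneg_left hτ.1, le_sub_iff_add_le.1 hτ.2⟩

theorem IsAdmissible.integrableOn (hu : IsAdmissible T u) : IntegrableOn u (Icc 0 T) :=
  hu.memLp.integrable one_le_two

end InflowProducing

section OptimalControl

variable {Ω : Type*} [MeasurableSpace Ω] {P : Measure Ω} {Y : ℝ → Ω → ℝ}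
  {lam s b T θ : ℝ} {ρ₀ u S m v q : ℝ → ℝ} {I : Set ℝ}

theorem IsFeasible.normalQuantileBound_le
    (hY : ∀ t ∈ Icc (b / lam) T, HasLaw (Y t) (gaussianReal (m t) (v t).toNNReal) P)
    (hθ0 : 0 < θ) (hθ1 : θ < 1) (hI : Icc (b / lam) T ⊆ I)
    (h : IsFeasible P Y lam s b T ρ₀ θ I u S) :
    ∀ t ∈ Icc (b / lam) T, normalQuantileBound m v θ t ≤ S t := fun t ht =>
  (ofReal_le_measure_le_iff (hY t ht) (sub_pos.2 hθ1) (sub_lt_self 1 hθ0) (S t)).1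
    (h.chance t (hI ht))

variable [IsProbabilityMeasure P]

theorem exists_isFeasible_outflow_ae_eq (hlam : 0 < lam) (hb : 0 ≤ b) (hT : 0 ≤ T)
    (hρ₀ : IntegrableOn ρ₀ (Icc 0 b)) (hθ : 0 < θ) (hIT : I ⊆ Icc 0 T)
    (hinit : ∀ᵐ t : ℝ, t ∈ I → t < b / lam →
      ENNReal.ofReal (1 - θ) ≤ P {w | Y t w ≤ Real.exp (s * t) * ρ₀ (b - lam * t)})
    (hq : SingleChanceConstraint P Y θ (Icc (b / lam) T) q) (hu : IsAdmissible T u)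
    (huq : ∀ᵐ t ∂(volume.restrict (Icc 0 (T - b / lam))), u t = inflowProducing lam s b q t) :
    ∃ S, IsFeasible P Y lam s b T ρ₀ θ I u S ∧ S =ᵐ[volume.restrict (Icc (b / lam) T)] q := by
  have hout : (fun t => characteristicDensity lam s ρ₀ u (b, t))
      =ᵐ[volume.restrict (Icc (b / lam) T)] q := characteristicDensity_outflow_ae_eq_iff.2 huq
  have hchance : ∀ᵐ t, t ∈ I →
      ENNReal.ofReal (1 - θ) ≤ P {w | Y t w ≤ characteristicDensity lam s ρ₀ u (b, t)} := by
    filter_upwards [hinit, (ae_restrict_iff' measurableSet_Icc).1 hout] with t ht_init ht_out htI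
    rcases lt_or_ge t (b / lam) with hearly | hlate
    · rw [characteristicDensity_of_lt hlam hearly]
      exact ht_init htI hearly
    · have ht : t ∈ Icc (b / lam) T := ⟨hlate, (hIT htI).2⟩
      rw [ht_out ht]
      exact hq t ht
  obtain ⟨S, hS, hS_chance⟩ := exists_ae_eq_singleChanceConstraint hθ hchance
  exact ⟨S, ⟨hu, (isSupply_iff hlam hb hT hρ₀ hu.integrableOn).2 hS.restrict, hS_chance⟩,
    hS.restrict.trans hout⟩

theorem isOptimalControl_iff (hlam : 0 < lam) (hb : 0 ≤ b) (hT : b / lam ≤ T)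
    (hρ₀ : IntegrableOn ρ₀ (Icc 0 b)) (hm : ContinuousOn m (Icc (b / lam) T))
    (hv : ContinuousOn v (Icc (b / lam) T))
    (hY : ∀ t ∈ Icc (b / lam) T, HasLaw (Y t) (gaussianReal (m t) (v t).toNNReal) P)
    (hθ0 : 0 < θ) (hθ : θ ≤ 1 / 2) (hI : Icc (b / lam) T ⊆ I) (hIT : I ⊆ Icc 0 T)
    (hinit : ∀ᵐ t : ℝ, t ∈ I → t < b / lam →
      ENNReal.ofReal (1 - θ) ≤ P {w | Y t w ≤ Real.exp (s * t) * ρ₀ (b - lam * t)})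
    (hpos : ∀ t ∈ Icc (b / lam) T, 0 ≤ normalQuantileBound m v θ t) :
    IsOptimalControl P Y lam s b T ρ₀ θ I u ↔ IsAdmissible T u ∧
      ∀ᵐ t ∂(volume.restrict (Icc 0 (T - b / lam))),
        u t = inflowProducing lam s b (normalQuantileBound m v θ) t := by
  set q := normalQuantileBound m v θ
  have hθ1 : θ < 1 := by linarith
  have hdelay : 0 ≤ b / lam := div_nonneg hb hlam.le
  have hT0 : 0 ≤ T := hdelay.trans hT
  have hsub : Icc (b / lam) T ⊆ Icc 0 T := Icc_subset_Icc_left hdelay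
  have hq_cont : ContinuousOn q (Icc (b / lam) T) := continuousOn_normalQuantileBound hm hv θ
  have hmq : ∀ t ∈ Icc (b / lam) T, m t ≤ q t := fun t _ => le_normalQuantileBound hθ0 hθ m v t
  have hq_chance : SingleChanceConstraint P Y θ (Icc (b / lam) T) q := fun t ht =>
    (ofReal_le_measure_le_iff (hY t ht) (sub_pos.2 hθ1) (sub_lt_self 1 hθ0) _).2 le_rfl
  constructor
  · rintro ⟨S, hS, hS_min⟩
    refine ⟨hS.admissible, (characteristicDensity_outflow_ae_eq_iff (ρ₀ := ρ₀)).1 ?_⟩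
    obtain ⟨S', hS', hS'q⟩ := exists_isFeasible_outflow_ae_eq hlam hb hT0 hρ₀ hθ0 hIT hinit
      hq_chance (isAdmissible_indicator_inflowProducing (s := s) hq_cont hpos)
      (ae_restrict_of_forall_mem measurableSet_Icc fun t ht => indicator_of_mem ht _)
    have hcost : trackingCost P Y (b / lam) T S ≤ trackingCost P Y (b / lam) T q :=
      (hS_min _ S' hS').trans_eq (trackingCost_congr hS'q)
    have hS_meas : AEMeasurable S (volume.restrict (Icc (b / lam) T)) := by
      obtain ⟨ρ, hρ⟩ := hS.supply
      exact (hρ.integrableOn_outflow.mono_set hsub).aemeasurable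
    have hSq : S =ᵐ[volume.restrict (Icc (b / lam) T)] q :=
      ae_eq_of_trackingCost_le hY (hm.aemeasurable measurableSet_Icc)
        (hv.aemeasurable measurableSet_Icc) hS_meas hmq
        (hS.normalQuantileBound_le hY hθ0 hθ1 hI) (trackingCost_ne_top hY hm hv hq_cont) hcost
    have hS_out : S =ᵐ[volume.restrict (Icc (b / lam) T)]
        fun t => characteristicDensity lam s ρ₀ u (b, t) :=
      ae_restrict_of_ae_restrict_of_subset hsub
        ((isSupply_iff hlam hb hT0 hρ₀ hS.admissible.integrableOn).1 hS.supply)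
    exact hS_out.symm.trans hSq
  · rintro ⟨hu, huq⟩
    obtain ⟨S, hS, hSq⟩ := exists_isFeasible_outflow_ae_eq hlam hb hT0 hρ₀ hθ0 hIT hinit
      hq_chance hu huq
    refine ⟨S, hS, fun u' S' hS' => ?_⟩
    rw [trackingCost_congr hSq]
    exact trackingCost_mono hY hmq (hS'.normalQuantileBound_le hY hθ0 hθ1 hI)

end OptimalControl

end SupplyControl

theorem mainTheorem1_general
    {Ω : Type*} [MeasurableSpace Ω] (P : Measure Ω) [IsProbabilityMeasure P]
    (lam s b T : ℝ) (hlam : 0 < lam) (hb : 0 ≤ b) (hT : b / lam ≤ T)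
    (ρ₀ : ℝ → ℝ) (hρ₀ : IntegrableOn ρ₀ (Icc 0 b))
    (m v : ℝ → ℝ) (hm : ContinuousOn m (Icc (b / lam) T)) (hv : ContinuousOn v (Icc (b / lam) T))
    (Y : ℝ → Ω → ℝ)
    (hY : ∀ t ∈ Icc (b / lam) T, HasLaw (Y t) (gaussianReal (m t) (v t).toNNReal) P)
    (θ : ℝ) (hθ0 : 0 < θ) (hθ : θ ≤ 1 / 2)
    (I : Set ℝ) (hI : Icc (b / lam) T ⊆ I) (hIT : I ⊆ Icc 0 T)
    (hinit : ∀ᵐ t : ℝ, t ∈ I → t < b / lam →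
      ENNReal.ofReal (1 - θ) ≤ P {w | Y t w ≤ Real.exp (s * t) * ρ₀ (b - lam * t)})
    (hpos : ∀ t ∈ Icc (b / lam) T, 0 ≤ SupplyControl.normalQuantileBound m v θ t) :
    (∃ u : ℝ → ℝ, SupplyControl.IsOptimalControl P Y lam s b T ρ₀ θ I u ∧
      ∀ t ∈ Icc 0 (T - b / lam), u t =
        SupplyControl.inflowProducing lam s b (SupplyControl.normalQuantileBound m v θ) t) ∧
    (∀ u : ℝ → ℝ, SupplyControl.IsOptimalControl P Y lam s b T ρ₀ θ I u ↔
      SupplyControl.IsAdmissible T u ∧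
      ∀ᵐ t ∂(volume.restrict (Icc 0 (T - b / lam))), u t =
        SupplyControl.inflowProducing lam s b (SupplyControl.normalQuantileBound m v θ) t) := by
  have hiff (u : ℝ → ℝ) := SupplyControl.isOptimalControl_iff (u := u) hlam hb hT hρ₀ hm hv hY
    hθ0 hθ hI hIT hinit hpos
  have hq := SupplyControl.continuousOn_normalQuantileBound hm hv θ
  refine ⟨⟨_, (hiff _).2 ⟨SupplyControl.isAdmissible_indicator_inflowProducing hq hpos,
    ae_restrict_of_forall_mem measurableSet_Icc fun t ht => indicator_of_mem ht _⟩,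
    fun t ht => indicator_of_mem ht _⟩, hiff⟩

theorem mainTheorem1
    {Ω : Type*} [MeasurableSpace Ω] (P : Measure Ω) [IsProbabilityMeasure P]
    (W : ℝ≥0 → Ω → ℝ) (hW : IsBrownianReal W P)
    (lam s b T : ℝ) (hlam : 0 < lam) (hb : 0 < b) (hT : b / lam ≤ T)
    (ρ₀ : ℝ → ℝ) (hρ₀ : IntegrableOn ρ₀ (Icc 0 b))
    (κ σ y₀ : ℝ) (hκ : 0 < κ) (hσ : 0 < σ)
    (μ : ℝ → ℝ) (hμ : IntegrableOn μ (Icc 0 T))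
    (Y : ℝ → Ω → ℝ) (hY : SupplyControl.IsOUProcess P W κ σ y₀ μ T Y)
    (θ : ℝ) (hθ0 : 0 < θ) (hθ : θ ≤ 1 / 2)
    -- the chance constraint is active at all times at which the control can act
    (I : Set ℝ) (hI : Icc (b / lam) T ⊆ I) (hIT : I ⊆ Icc 0 T)
    -- wherever it is also imposed before the inflow reaches the demand node, the outflow of the
    -- initial state satisfies it (void for `I = Icc (b / lam) T`)
    (hinit : ∀ᵐ t : ℝ, t ∈ I → t < b / lam →
      ENNReal.ofReal (1 - θ) ≤ P {w | Y t w ≤ Real.exp (s * t) * ρ₀ (b - lam * t)})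
    -- the quantile bound respects the lower bound `0` on the control
    (hpos : ∀ t ∈ Icc (b / lam) T, 0 ≤ SupplyControl.quantileBound κ σ y₀ μ θ t) :
    (∃ u : ℝ → ℝ, SupplyControl.IsOptimalControl P Y lam s b T ρ₀ θ I u ∧
      ∀ t ∈ Icc 0 (T - b / lam), u t = SupplyControl.optimalInflow lam s b κ σ y₀ μ θ t) ∧
    (∀ u : ℝ → ℝ, SupplyControl.IsOptimalControl P Y lam s b T ρ₀ θ I u ↔
      SupplyControl.IsAdmissible T u ∧
      ∀ᵐ t ∂(volume.restrict (Icc 0 (T - b / lam))),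
        u t = SupplyControl.optimalInflow lam s b κ σ y₀ μ θ t) := by
  have hdelay : 0 < b / lam := div_pos hb hlam
  exact mainTheorem1_general P lam s b T hlam hb.le hT ρ₀ hρ₀ _ _
    ((SupplyControl.continuousOn_meanOUP hμ).mono (Icc_subset_Icc_left hdelay.le))
    (SupplyControl.continuous_varOUP κ σ).continuousOn Y
    (fun t ht => hY.hasLaw hW hκ.ne' hμ ⟨hdelay.trans_le ht.1, ht.2⟩)
    θ hθ0 hθ I hI hIT hinit hpos
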